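/- Let $\mathcal S\subset\mathbb R^3$ be the unit sphere with surface measure $\sigma$ and outer unit normal $\vec e_r(x)=x$. Let $\nabla_{\mathcal S}$ and $\Delta_{\mathcal S}$ be the surface gradient and the Laplace--Beltrami operator of $\mathcal S$, and let $\underline{\mathrm{curl}}_{\mathcal S} f=\nabla_{\mathcal S}f\times\vec e_r$ be the vectorial surface rotation, i.e. $\underline{\mathrm{curl}}_{\mathcal S} f=-\partial_\theta f\,\vec e_\varphi+\frac1{\sin\theta}\partial_\varphi f\,\vec e_\theta$ in spherical coordinates. Let $\mathcal C\subset\mathcal S$ be a simple closed regular curve of class $C^1$ which divides $\mathcal S$ into two disjoint open parts, $\mathcal S\setminus\mathcal C=\mathcal S_1\cup\mathcal S_2$, with $\partial\mathcal S_1=\partial\mathcal S_2=\mathcal C$. Let $\mathcal C$ be positively oriented as the boundary of $\mathcal S_2$, i.e. its unit tangent vector $\vec t$ is such that $\vec e_r\times\vec t$ points into $\mathcal S_2$, and let $ds$ be its arc length element. For $x\ne x_0$ in $\mathcal S$ put $$U^*(x,x_0)=-\frac1{4\pi}\log\bigl(1-\langle x,x_0\rangle\bigr).$$ Let $u\in C^2(\mathcal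 S_2)\cap C^1(\overline{\mathcal S_2})$ be such that $\Delta_{\mathcal S}u$ is integrable over $\mathcal S_2$. Then for every $x_0\in\mathcal S\setminus\mathcal C$ the function $U^*(\cdot,x_0)\,\Delta_{\mathcal S}u$ is integrable over $\mathcal S_2$, and $$\frac1{4\pi}\int_{\mathcal S_2}u\,d\sigma-\int_{\mathcal S_2}U^*(x,x_0)\,\Delta_{\mathcal S}u(x)\,d\sigma_x-\int_{\mathcal C}U^*(x,x_0)\,\underline{\mathrm{curl}}_{\mathcal S}u(x)\cdot\vec t(x)\,ds_x+\int_{\mathcal C}u(x)\,\underline{\mathrm{curl}}_{\mathcal S}U^*(x,x_0)\cdot\vec t(x)\,ds_x=\begin{cases}u(x_0)&\text{if }x_0\in\mathcal S_2,\\0&\text{if }x_0\in\mathcal S_1=\mathcal S\setminus\overline{\mathcal S_2}.\end{cases}$$ Here the values of $\underline{\mathrm{curl}}_{\mathcal S}u$ on $\mathcal C$ are those of its continuous extension from $\mathcal S_2$, and the curl of $U^*(x,x_0)$ is taken with respect to $x$. -/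

import Mathlib

open MeasureTheory Set Filter Topology
open scoped Manifold RealInnerProductSpace

noncomputable section

namespace SphereRepr

/-- Euclidean three-space. -/
abbrev E3 : Type := EuclideanSpace ℝ (Fin 3)

/-- The unit sphere in `E3`, with Mathlib's topology, manifold structure and Borel structure. -/
abbrev Sph : Type := Metric.sphere (0 : E3) 1

/-- The surface measure of the unit sphere (of total mass `4π`). -/
def area : Measure Sph := (volume : Measure E3).toSphere

/-- The cross product of `E3`. -/
def cross (v w : E3) : E3 := WithLp.toLp 2 (crossProduct v.ofLp w.ofLp)

/-- The radial projection `y ↦ y / |y|` onto the sphere (the value at `0` is irrelevant). -/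
def radial (y : E3) : Sph :=
  if h : y ≠ 0 then ⟨‖y‖⁻¹ • y, by simp [norm_smul, h]⟩
  else ⟨EuclideanSpace.single 0 1, by simp⟩

/-- The extension of a function on the sphere that is constant on rays from the origin. -/
def homExt (f : Sph → ℝ) (y : E3) : ℝ := f (radial y)

/-- The surface gradient `∇_S f`: on the sphere it is the Euclidean gradient of the extension of
`f` that is constant on rays. In spherical coordinates it is
`(1 / sin θ) ∂_φ f e_φ + ∂_θ f e_θ`. -/
def surfGrad (f : Sph → ℝ) (x : Sph) : E3 := gradient (homExt f) (x : E3)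

/-- The vectorial surface rotation `curl_S f = ∇_S f × e_r`, where `e_r` is the outer unit normal
of the sphere. In spherical coordinates it is `- ∂_θ f e_φ + (1 / sin θ) ∂_φ f e_θ`. -/
def surfCurl (f : Sph → ℝ) (x : Sph) : E3 := cross (surfGrad f x) (x : E3)

/-- The Laplace-Beltrami operator of the sphere: on the sphere it is the Euclidean Laplacian of the
extension of `f` that is constant on rays. -/
def laplaceBeltrami (f : Sph → ℝ) (x : Sph) : ℝ :=
  Laplacian.laplacian (homExt f) (x : E3)

/-- The fundamental solution `U*(x, x₀) = -(1 / 4π) log (1 - ⟨x, x₀⟩)`. -/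
def fundSol (x x₀ : Sph) : ℝ :=
  -(1 / (4 * Real.pi)) * Real.log (1 - ⟪(x : E3), (x₀ : E3)⟫)

/-- `f ∈ C²(S)`, for an open subset `S` of the sphere. -/
def IsC2On (f : Sph → ℝ) (S : Set Sph) : Prop :=
  ContMDiffOn (𝓡 2) 𝓘(ℝ, ℝ) 2 f S

/-- `f ∈ C¹(closure S)`, for an open subset `S` of the sphere: `f` is `C¹` on `S`, and `f` and its
surface gradient extend continuously from `S` to the closure of `S`. -/
structure IsC1UpToBoundary (f : Sph → ℝ) (S : Set Sph) : Prop where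
  contMDiffOn : ContMDiffOn (𝓡 2) 𝓘(ℝ, ℝ) 1 f S
  continuousOn : ContinuousOn f (closure S)
  exists_grad : ∃ G : Sph → E3, ContinuousOn G (closure S) ∧ EqOn G (surfGrad f) S

/-- The continuous extension of `curl_S f` from `S` to the closure of `S`. -/
def boundaryCurl (f : Sph → ℝ) (S : Set Sph) : Sph → E3 :=
  extendFrom S (surfCurl f)

/-- The velocity vector of a curve on the sphere. -/
def velocity (γ : ℝ → Sph) (s : ℝ) : E3 := deriv (fun r => (γ r : E3)) s

/-- The unit tangent vector of a curve on the sphere. -/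
def unitTangent (γ : ℝ → Sph) (s : ℝ) : E3 := ‖velocity γ s‖⁻¹ • velocity γ s

/-- `γ`, run through once over a period `L`, is a simple closed regular curve of class `C¹`. -/
structure IsSimpleClosedCurve (γ : ℝ → Sph) (L : ℝ) : Prop where
  pos : 0 < L
  contDiff : ContDiff ℝ 1 (fun s => (γ s : E3))
  periodic : Function.Periodic γ L
  injOn : InjOn γ (Ico 0 L)
  velocity_ne_zero : ∀ s, velocity γ s ≠ 0

/-- The curve `γ` divides the sphere into the two parts `S₁` and `S₂`, and is their common
boundary. -/
structure Divides (γ : ℝ → Sph) (S₁ S₂ : Set Sph) : Prop where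
  isOpen₁ : IsOpen S₁
  isOpen₂ : IsOpen S₂
  disjoint : Disjoint S₁ S₂
  union : S₁ ∪ S₂ = (range γ)ᶜ
  frontier₁ : frontier S₁ = range γ
  frontier₂ : frontier S₂ = range γ

/-- The curve `γ` is positively oriented as the boundary of `S`, in the sense of Stokes' theorem
with respect to the outer normal `e_r` of the sphere: `S` lies to the left of `γ`, that is, the
direction `e_r × t` points from the curve into `S`. -/
def PositivelyOriented (γ : ℝ → Sph) (S : Set Sph) : Prop :=
  ∀ s, ∀ᶠ ε in 𝓝[>] (0 : ℝ),
    radial ((γ s : E3) + ε • cross (γ s : E3) (unitTangent γ s)) ∈ S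

/-- The line integral `∫_C V · t ds` along the closed curve `γ` of period `L`. -/
def lineIntegral (γ : ℝ → Sph) (L : ℝ) (V : Sph → E3) : ℝ :=
  ∫ s in (0 : ℝ)..L, ⟪V (γ s), unitTangent γ s⟫ * ‖velocity γ s‖

/-- The left-hand side of the representation formula. -/
def reprLHS (γ : ℝ → Sph) (L : ℝ) (S : Set Sph) (u : Sph → ℝ) (x₀ : Sph) : ℝ :=
  1 / (4 * Real.pi) * (∫ x in S, u x ∂area)
    - (∫ x in S, fundSol x x₀ * laplaceBeltrami u x ∂area)
    - lineIntegral γ L (fun x => fundSol x x₀ • boundaryCurl u S x)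
    + lineIntegral γ L (fun x => u x • surfCurl (fun y => fundSol y x₀) x)

end SphereRepr

end

noncomputable section

namespace SphereRepr

/-! ### The radial projection and cones over subsets of the sphere -/

/-! The singularity of `U*` is removed by replacing it with `U_ε = -(1/4π) log(1 + ε - t)`, where `t
= ⟨x, x₀⟩`. For `ε > 0` this is smooth on the whole sphere, and `Δ_S U_ε = 1/4π - K_ε` with `K_ε =
(2ε + ε²) / (4π (1 + ε - t)²)`. The kernel `K_ε` is nonnegative and tends to zero uniformly away
from `x₀`. Its integral is 1, because the integral of `Δ_S U_ε` over the sphere vanishes and the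
sphere has area `4π`.

The divergence theorem on `S₂`, applied to `u ∇U_ε - U_ε ∇u`, expresses `∫ K_ε u` over `S₂` through
area and line integrals (`green_regSol`). As `ε → 0` these tend to the left-hand side of the formula
(`tendsto_integral_regKernel_reprLHS`): the line integrals because `x₀` is off the curve, the area
integral of `U_ε Δu` by domination. Meanwhile `∫ K_ε u` tends to the value at `x₀` of `u` extended
by zero (`tendsto_integral_regKernel`), that is, `u(x₀)` or `0`.

The main labour is the divergence theorem `integral_surfDiv_eq_integral_det3`, for a `C¹` curve and
a tangential field that is only continuous up to the curve, with integrable divergence. It is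
localised by a partition of unity and proved in charts obtained by projecting a ruled surface `c(s)
+ τ n` to the sphere. Near the boundary `c` is the curve itself and `n` a fixed vector. Such a chart
is affine in `τ`, so the pulled-back form of the field can be differentiated without a second
derivative of `c`; and the curve becomes the side `τ = 0` of a rectangle, which is approached from
`τ > 0`.

Calculus on the sphere is done in Euclidean space: functions are extended with degree 0 and
tangential fields with degree -1, so that surface gradient, divergence and Laplacian are the
Euclidean ones. -/

lemma coe_radial {y : E3} (hy : y ≠ 0) : (radial y : E3) = ‖y‖⁻¹ • y := by
  simp [radial, hy]

lemma norm_coe_sph (x : Sph) : ‖(x : E3)‖ = 1 := by simp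

lemma coe_sph_ne_zero (x : Sph) : (x : E3) ≠ 0 := by
  intro h
  have := norm_coe_sph x
  simp [h] at this

lemma radial_coe (x : Sph) : radial (x : E3) = x := by
  apply Subtype.ext
  rw [coe_radial (coe_sph_ne_zero x)]
  simp

lemma radial_smul {r : ℝ} (hr : 0 < r) {y : E3} (hy : y ≠ 0) : radial (r • y) = radial y := by
  apply Subtype.ext
  rw [coe_radial hy, coe_radial (smul_ne_zero hr.ne' hy), norm_smul, smul_smul,
    Real.norm_of_nonneg hr.le]
  congr 1
  field_simp

lemma norm_smul_radial {y : E3} (hy : y ≠ 0) : ‖y‖ • (radial y : E3) = y := by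
  rw [coe_radial hy, smul_smul, mul_inv_cancel₀ (norm_ne_zero_iff.2 hy), one_smul]

/-- Smoothness into the sphere is inherited from smoothness into space, for maps defined on an
entire manifold; hence the detour through the open submanifold of nonzero vectors. -/
lemma contMDiffAt_radial {n : WithTop ℕ∞} {y : E3} (hy : y ≠ 0) :
    ContMDiffAt 𝓘(ℝ, E3) (𝓡 2) n radial y := by
  let V : TopologicalSpace.Opens E3 := ⟨{y | y ≠ 0}, isOpen_ne⟩
  have h1 : ContMDiff 𝓘(ℝ, E3) 𝓘(ℝ, E3) n (fun z : V => ‖(z : E3)‖⁻¹ • (z : E3)) := by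
    intro z
    have hz : (z : E3) ≠ 0 := z.2
    have : ContMDiffAt 𝓘(ℝ, E3) 𝓘(ℝ, E3) n (fun y : E3 => ‖y‖⁻¹ • y) (z : E3) := by
      apply ContDiffAt.contMDiffAt
      exact ((contDiffAt_norm ℝ hz).inv (norm_ne_zero_iff.2 hz)).smul contDiffAt_id
    exact contMDiffAt_subtype_iff.2 this
  have : Fact (Module.finrank ℝ E3 = 2 + 1) := ⟨by simp⟩
  have hn : ∀ z : V, ‖(z : E3)‖⁻¹ • (z : E3) ∈ Metric.sphere (0 : E3) 1 := fun z => by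
    have hz : (z : E3) ≠ 0 := z.2
    simp [norm_smul, hz]
  have h2 : ContMDiff 𝓘(ℝ, E3) (𝓡 2) n
      (codRestrict (fun z : V => ‖(z : E3)‖⁻¹ • (z : E3)) (Metric.sphere (0 : E3) 1) hn) :=
    h1.codRestrict_sphere hn
  have h3 : ContMDiffAt 𝓘(ℝ, E3) (𝓡 2) n (fun z : V => radial (z : E3)) ⟨y, hy⟩ := by
    have he : (fun z : V => radial (z : E3)) =
        codRestrict (fun z : V => ‖(z : E3)‖⁻¹ • (z : E3)) (Metric.sphere (0 : E3) 1) hn := by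
      funext z
      apply Subtype.ext
      have hz : (z : E3) ≠ 0 := z.2
      simp [coe_radial hz]
    rw [he]
    exact h2 ⟨y, hy⟩
  exact contMDiffAt_subtype_iff.1 h3

lemma continuousAt_radial {y : E3} (hy : y ≠ 0) : ContinuousAt radial y :=
  (contMDiffAt_radial (n := 0) hy).continuousAt

lemma continuousOn_radial : ContinuousOn radial {y : E3 | y ≠ 0} :=
  fun _ hy => (continuousAt_radial hy).continuousWithinAt

lemma measurable_radial : Measurable radial := by
  have h : Measurable fun y : E3 =>
      if y ≠ 0 then ‖y‖⁻¹ • y else (EuclideanSpace.single 0 1 : E3) :=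
    Measurable.ite (measurableSet_singleton (0 : E3)).compl (by fun_prop) measurable_const
  have h' : Measurable fun y : E3 => (radial y : E3) := by
    convert h using 2 with y
    unfold radial
    split_ifs <;> rfl
  exact h'.subtype_mk (h := fun y => (radial y).2)

/-- The open cone over a subset of the sphere. -/
def cone (S : Set Sph) : Set E3 := {y | y ≠ 0 ∧ radial y ∈ S}

lemma isOpen_cone {S : Set Sph} (hS : IsOpen S) : IsOpen (cone S) :=
  continuousOn_radial.isOpen_inter_preimage isOpen_ne hS

lemma coe_mem_cone {S : Set Sph} {x : Sph} : (x : E3) ∈ cone S ↔ x ∈ S := by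
  simp [cone, radial_coe, coe_sph_ne_zero]

lemma ContMDiffOn.contDiffOn_homExt {n : WithTop ℕ∞} {f : Sph → ℝ} {S : Set Sph}
    (hf : ContMDiffOn (𝓡 2) 𝓘(ℝ, ℝ) n f S) : ContDiffOn ℝ n (homExt f) (cone S) := by
  rw [← contMDiffOn_iff_contDiffOn]
  exact hf.comp (fun y hy => (contMDiffAt_radial hy.1).contMDiffWithinAt) fun y hy => hy.2

lemma contDiffAt_coe_radial {n : WithTop ℕ∞} {y : E3} (hy : y ≠ 0) :
    ContDiffAt ℝ n (fun y => (radial y : E3)) y := by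
  have : ContDiffAt ℝ n (fun y : E3 => ‖y‖⁻¹ • y) y :=
    ((contDiffAt_norm ℝ hy).inv (norm_ne_zero_iff.2 hy)).smul contDiffAt_id
  refine this.congr_of_eventuallyEq ?_
  filter_upwards [isOpen_ne.mem_nhds hy] with z hz using coe_radial hz

/-! ### Vector fields on the sphere -/

/-- The extension of a vector field on the sphere that is homogeneous of degree `-1`. -/
def extField (f : Sph → E3) (y : E3) : E3 := ‖y‖⁻¹ • f (radial y)

/-- The Euclidean divergence. -/
def divE (F : E3 → E3) (y : E3) : ℝ :=
  ∑ i : Fin 3, (fderiv ℝ F y (EuclideanSpace.single i 1)) i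

/-- The surface divergence of a tangential vector field. -/
def surfDiv (f : Sph → E3) (x : Sph) : ℝ := divE (extField f) x

/-- A tangential vector field on the open set `S`, continuous up to the boundary, of class `C¹`
inside, with integrable surface divergence. -/
structure IsDivField (f : Sph → E3) (S : Set Sph) : Prop where
  continuousOn : ContinuousOn f (closure S)
  contDiffOn : ContDiffOn ℝ 1 (extField f) (cone S)
  tangent : ∀ x ∈ S, ⟪f x, (x : E3)⟫ = 0
  integrable : IntegrableOn (surfDiv f) S area

lemma extField_coe (f : Sph → E3) (x : Sph) : extField f x = f x := by
  simp [extField, radial_coe]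

lemma extField_smul (f : Sph → E3) {r : ℝ} (hr : 0 < r) {y : E3} (hy : y ≠ 0) :
    extField f (r • y) = r⁻¹ • extField f y := by
  simp only [extField, radial_smul hr hy, norm_smul, Real.norm_of_nonneg hr.le, smul_smul, mul_inv]

/-- Euler's relation for fields that are homogeneous of degree `-1`. -/
lemma fderiv_extField_self {f : Sph → E3} {y : E3} (hy : y ≠ 0)
    (hf : DifferentiableAt ℝ (extField f) y) :
    fderiv ℝ (extField f) y y = -extField f y := by
  have h1 : HasDerivAt (fun r : ℝ => extField f (r • y)) (fderiv ℝ (extField f) y y) 1 := by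
    have hd : HasDerivAt (fun r : ℝ => r • y) y 1 := by
      simpa using (hasDerivAt_id (1 : ℝ)).smul_const y
    have hf' : HasFDerivAt (extField f) (fderiv ℝ (extField f) y) ((1 : ℝ) • y) := by
      simpa using hf.hasFDerivAt
    exact hf'.comp_hasDerivAt 1 hd
  have h2 : HasDerivAt (fun r : ℝ => r⁻¹ • extField f y) (-extField f y) 1 := by
    simpa using (hasDerivAt_inv (one_ne_zero (α := ℝ))).smul_const (extField f y)
  have h3 : (fun r : ℝ => extField f (r • y)) =ᶠ[𝓝 1] fun r => r⁻¹ • extField f y := by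
    filter_upwards [lt_mem_nhds (zero_lt_one' ℝ)] with r hr using extField_smul f hr hy
  exact h1.unique (h2.congr_of_eventuallyEq h3)

/-- The divergence of a field that is homogeneous of degree `-1` has degree `-2`. -/
lemma divE_extField {f : Sph → E3} {y : E3} (hy : y ≠ 0) :
    divE (extField f) y = (‖y‖⁻¹) ^ 2 * surfDiv f (radial y) := by
  have hr : 0 < ‖y‖⁻¹ := inv_pos.2 (norm_pos_iff.2 hy)
  -- Differentiating `F(r z) = r⁻¹ F(z)` in `z` shows that the derivative of `F` is homogeneous of
  -- degree -2.
  have h : fderiv ℝ (extField f) (radial y : E3) = (‖y‖ ^ 2) • fderiv ℝ (extField f) y := by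
    have h1 := fderiv_comp_smul (𝕜 := ℝ) (f := extField f) (x := y) ‖y‖⁻¹
    have h2 : (fun z => extField f (‖y‖⁻¹ • z)) =ᶠ[𝓝 y] (‖y‖ • extField f) := by
      filter_upwards [isOpen_ne.mem_nhds hy] with z hz
      rw [extField_smul f hr hz, inv_inv, Pi.smul_apply]
    rw [h2.fderiv_eq, fderiv_const_smul_field, Pi.smul_apply] at h1
    have hy' : ‖y‖ ≠ 0 := norm_ne_zero_iff.2 hy
    rw [coe_radial hy, pow_two, mul_smul, h1, smul_smul, mul_inv_cancel₀ hy', one_smul]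
  simp only [surfDiv, divE, h]
  have : ‖y‖ ≠ 0 := norm_ne_zero_iff.2 hy
  simp [Fin.sum_univ_three]
  field_simp

/-! ### Area of parametrised patches of the sphere -/

/-- The determinant of three vectors in space. -/
def det3 (a b c : E3) : ℝ :=
  a 0 * (b 1 * c 2 - b 2 * c 1) + a 1 * (b 2 * c 0 - b 0 * c 2) + a 2 * (b 0 * c 1 - b 1 * c 0)

/-- The ruled surface `(s, τ) ↦ c(s) + τ n`. -/
def ruled (c : ℝ → E3) (n : E3) (q : ℝ × ℝ) : E3 := c q.1 + q.2 • n

/-- The radial projection of a ruled surface. -/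
def patch (c : ℝ → E3) (n : E3) (q : ℝ × ℝ) : Sph := radial (ruled c n q)

/-- The cone over a ruled surface, parametrised by `(s, τ, r) ↦ r (c(s) + τ n)`. -/
def polarMap (c : ℝ → E3) (n : E3) (q : E3) : E3 := q 2 • (c (q 0) + q 1 • n)

/-- The derivative of `polarMap`. -/
def polarDeriv (c : ℝ → E3) (n : E3) (q : E3) : E3 →L[ℝ] E3 :=
  q 2 • ((EuclideanSpace.proj 0 : E3 →L[ℝ] ℝ).smulRight (deriv c (q 0)) +
    (EuclideanSpace.proj 1 : E3 →L[ℝ] ℝ).smulRight n) +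
    (EuclideanSpace.proj 2 : E3 →L[ℝ] ℝ).smulRight (c (q 0) + q 1 • n)

lemma hasFDerivAt_polarMap {c : ℝ → E3} (hc : ContDiff ℝ 1 c) (n q : E3) :
    HasFDerivAt (polarMap c n) (polarDeriv c n q) q := by
  have h0 : ∀ i : Fin 3, HasFDerivAt (fun q : E3 => q i) (EuclideanSpace.proj i : E3 →L[ℝ] ℝ) q :=
    fun i => (EuclideanSpace.proj i : E3 →L[ℝ] ℝ).hasFDerivAt
  have h1 : HasFDerivAt (fun q : E3 => c (q 0))
      ((EuclideanSpace.proj 0 : E3 →L[ℝ] ℝ).smulRight (deriv c (q 0))) q := by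
    have hd := ((hc.differentiable one_ne_zero) (q 0)).hasDerivAt.hasFDerivAt
    refine (hd.comp q (h0 0)).congr_fderiv ?_
    ext v
    simp
  have h2 : HasFDerivAt (fun q : E3 => q 1 • n)
      ((EuclideanSpace.proj 1 : E3 →L[ℝ] ℝ).smulRight n) q := (h0 1).smul_const n
  exact (h0 2).smul (h1.add h2)

/-- The columns are `r c'`, `r n` and `c + τ n`; the term `τ n` drops out because of the second
column. -/
lemma det_polarDeriv (c : ℝ → E3) (n q : E3) :
    (polarDeriv c n q).det = q 2 ^ 2 * det3 (deriv c (q 0)) n (c (q 0)) := by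
  rw [ContinuousLinearMap.det, ← LinearMap.det_toMatrix (EuclideanSpace.basisFun (Fin 3) ℝ).toBasis,
    Matrix.det_fin_three]
  simp [LinearMap.toMatrix_apply, polarDeriv, det3]
  ring

lemma contDiff_polarMap {c : ℝ → E3} (hc : ContDiff ℝ 1 c) (n : E3) :
    ContDiff ℝ 1 (polarMap c n) := by
  have h0 : ∀ i : Fin 3, ContDiff ℝ 1 (fun q : E3 => q i) :=
    fun i => (EuclideanSpace.proj i : E3 →L[ℝ] ℝ).contDiff
  exact (h0 2).smul ((hc.comp (h0 0)).add ((h0 1).smul contDiff_const))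

lemma continuous_ruled {c : ℝ → E3} (hc : Continuous c) (n : E3) : Continuous (ruled c n) := by
  unfold ruled
  fun_prop

lemma measurable_patch {c : ℝ → E3} (hc : Continuous c) (n : E3) : Measurable (patch c n) :=
  measurable_radial.comp (continuous_ruled hc n).measurable

lemma det3_add_smul (a n c : E3) (t : ℝ) : det3 a n (c + t • n) = det3 a n c := by
  simp [det3]
  ring

/-- Transversality at `τ = 0` persists along the whole ruling, since adding a multiple of `n` does
not change the determinant. -/
lemma ruled_ne_zero {c : ℝ → E3} {n : E3} {q : ℝ × ℝ}
    (h : det3 (deriv c q.1) n (c q.1) ≠ 0) : ruled c n q ≠ 0 := by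
  intro h0
  apply h
  rw [← det3_add_smul _ _ _ q.2]
  change det3 _ _ (ruled c n q) = 0
  rw [h0]
  simp [det3]

/-- The splitting of the coordinates of space. -/
def splitCoord (q : E3) : (ℝ × ℝ) × ℝ := ((q 0, q 1), q 2)

lemma measurePreserving_splitCoord : MeasurePreserving splitCoord volume volume := by
  have h1 := PiLp.volume_preserving_ofLp (Fin 3)
  have h2 := volume_preserving_piFinSuccAbove (fun _ : Fin 3 => ℝ) 2
  have h3 := (volume_preserving_finTwoArrow ℝ)
  have h4 : MeasurePreserving (Prod.map (id : ℝ → ℝ) (MeasurableEquiv.finTwoArrow (α := ℝ)))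
      (volume.prod volume) (volume.prod volume) := (MeasurePreserving.id volume).prod h3
  have h5 : MeasurePreserving (Prod.swap : ℝ × (ℝ × ℝ) → (ℝ × ℝ) × ℝ) volume volume :=
    Measure.measurePreserving_swap
  exact h5.comp (h4.comp (h2.comp h1))

lemma lintegral_sq_Ioo {a : ℝ} (ha : 0 ≤ a) :
    ∫⁻ r in Ioo 0 a, ENNReal.ofReal (r ^ 2) = ENNReal.ofReal (a ^ 3 / 3) := by
  rw [← ofReal_integral_eq_lintegral_ofReal, ← integral_Ioc_eq_integral_Ioo,
    ← intervalIntegral.integral_of_le ha, integral_pow]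
  · norm_num
  · exact (continuous_pow 2).integrableOn_Icc.mono_set Ioo_subset_Icc_self
  · exact Eventually.of_forall fun r => sq_nonneg r

lemma measurableSet_patch_image {c : ℝ → E3} (hc : ContDiff ℝ 1 c) {n : E3} {R : Set (ℝ × ℝ)}
    (hR : MeasurableSet R) (hinj : InjOn (patch c n) R)
    (hdet : ∀ q ∈ R, det3 (deriv c q.1) n (c q.1) ≠ 0) : MeasurableSet (patch c n '' R) := by
  -- An injective continuous image of a Borel set is Borel.
  apply hR.image_of_continuousOn_injOn _ hinj
  intro q hq
  exact ((continuousAt_radial (ruled_ne_zero (hdet q hq))).comp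
    (continuous_ruled hc.continuous n).continuousAt).continuousWithinAt

open scoped Pointwise in
-- The area of a set is three times the volume of the truncated cone over it. This cone is the image
-- under `polarMap` of the region `0 < r < 1 / |c + τ n|`, where the Jacobian is `r²` times the
-- determinant; integrating `r²` yields `|c + τ n|⁻³ / 3`, and the factor 3 cancels.
lemma area_patch_image {c : ℝ → E3} (hc : ContDiff ℝ 1 c) {n : E3} {R : Set (ℝ × ℝ)}
    (hR : MeasurableSet R) (hinj : InjOn (patch c n) R)
    (hdet : ∀ q ∈ R, det3 (deriv c q.1) n (c q.1) ≠ 0) :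
    area (patch c n '' R) =
      ∫⁻ q in R, ENNReal.ofReal (|det3 (deriv c q.1) n (c q.1)| * (‖ruled c n q‖⁻¹) ^ 3) := by
  have hrc := continuous_ruled hc.continuous n
  have hdc : Continuous (deriv c) := hc.continuous_deriv le_rfl
  have hDc : Continuous fun s => det3 (deriv c s) n (c s) := by
    have := hc.continuous
    unfold det3
    fun_prop
  set K' : Set ((ℝ × ℝ) × ℝ) := {p | p.1 ∈ R ∧ p.2 ∈ Ioo 0 (‖ruled c n p.1‖⁻¹)} with hK'
  have hK'm : MeasurableSet K' := by
    have : Measurable fun p : (ℝ × ℝ) × ℝ => ‖ruled c n p.1‖⁻¹ :=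
      (hrc.measurable.comp measurable_fst).norm.inv
    exact (measurable_fst hR).inter ((measurableSet_lt measurable_const measurable_snd).inter
      (measurableSet_lt measurable_snd this))
  set K : Set E3 := splitCoord ⁻¹' K' with hK
  have hKm : MeasurableSet K := measurePreserving_splitCoord.measurable hK'm
  have himg : Ioo (0 : ℝ) 1 • ((↑) '' (patch c n '' R) : Set E3) = polarMap c n '' K := by
    ext y
    constructor
    · rintro ⟨t, ht, _, ⟨_, ⟨q, hq, rfl⟩, rfl⟩, rfl⟩
      have h0 := ruled_ne_zero (hdet q hq)
      have hpos : 0 < ‖ruled c n q‖⁻¹ := inv_pos.2 (norm_pos_iff.2 h0)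
      refine ⟨WithLp.toLp 2 ![q.1, q.2, t * ‖ruled c n q‖⁻¹], ⟨?_, ?_⟩, ?_⟩
      · simpa [splitCoord] using hq
      · refine ⟨?_, ?_⟩
        · simpa [splitCoord] using mul_pos ht.1 hpos
        · simpa [splitCoord] using mul_lt_of_lt_one_left hpos ht.2
      · simp only [polarMap, patch, coe_radial h0, smul_smul]
        rfl
    · rintro ⟨k, ⟨hk1, hk2⟩, rfl⟩
      have h0 := ruled_ne_zero (hdet _ hk1)
      have hpos : 0 < ‖ruled c n (splitCoord k).1‖ := norm_pos_iff.2 h0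
      refine ⟨k 2 * ‖ruled c n (splitCoord k).1‖, ⟨mul_pos hk2.1 hpos, ?_⟩, _,
        ⟨_, ⟨_, hk1, rfl⟩, rfl⟩, ?_⟩
      · have := mul_lt_mul_of_pos_right hk2.2 hpos
        rwa [inv_mul_cancel₀ hpos.ne'] at this
      · simp only [patch, mul_smul, norm_smul_radial h0]
        rfl
  have hinjK : InjOn (polarMap c n) K := by
    intro k hk l hl hkl
    have hk0 := ruled_ne_zero (hdet _ hk.1)
    have hl0 := ruled_ne_zero (hdet _ hl.1)
    have hr : ∀ m : E3, polarMap c n m = (m 2) • ruled c n (splitCoord m).1 := fun m => rfl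
    rw [hr, hr] at hkl
    have hp : patch c n (splitCoord k).1 = patch c n (splitCoord l).1 := by
      unfold patch
      rw [← radial_smul hk.2.1 hk0, ← radial_smul hl.2.1 hl0]
      exact congrArg radial hkl
    have h1 := hinj hk.1 hl.1 hp
    rw [h1] at hkl
    have h2 := smul_left_injective ℝ hl0 hkl
    have h3 := congrArg Prod.fst h1
    have h4 := congrArg Prod.snd h1
    ext i
    fin_cases i
    exacts [h3, h4, h2]
  have hvol : volume (polarMap c n '' K) =
      ∫⁻ q in R, ENNReal.ofReal (|det3 (deriv c q.1) n (c q.1)| * ((‖ruled c n q‖⁻¹) ^ 3 / 3)) := by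
    rw [← lintegral_abs_det_fderiv_eq_addHaar_image volume hKm
      (fun q _ => (hasFDerivAt_polarMap hc n q).hasFDerivWithinAt) hinjK]
    set g : (ℝ × ℝ) × ℝ → ENNReal := fun p =>
      ENNReal.ofReal |det3 (deriv c p.1.1) n (c p.1.1)| * ENNReal.ofReal (p.2 ^ 2) with hg
    have hgm : Measurable g := by
      have h1 : Continuous fun p : (ℝ × ℝ) × ℝ => |det3 (deriv c p.1.1) n (c p.1.1)| :=
        (hDc.comp (continuous_fst.comp continuous_fst)).abs
      have h2 : Continuous fun p : (ℝ × ℝ) × ℝ => p.2 ^ 2 := by fun_prop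
      exact h1.measurable.ennreal_ofReal.mul h2.measurable.ennreal_ofReal
    have e1 : ∀ q : E3, ENNReal.ofReal |(polarDeriv c n q).det| = g (splitCoord q) := by
      intro q
      rw [det_polarDeriv, abs_mul, hg, abs_of_nonneg (sq_nonneg _), mul_comm,
        ENNReal.ofReal_mul (abs_nonneg _)]
      rfl
    simp_rw [e1]
    rw [hK, measurePreserving_splitCoord.setLIntegral_comp_preimage hK'm hgm,
      ← lintegral_indicator hK'm, Measure.volume_eq_prod, lintegral_prod _
        (hgm.indicator hK'm).aemeasurable, ← lintegral_indicator hR]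
    congr 1
    ext q
    by_cases hq : q ∈ R
    · rw [indicator_of_mem hq, ENNReal.ofReal_mul (abs_nonneg _),
        ← lintegral_sq_Ioo (inv_nonneg.2 (norm_nonneg _)), ← lintegral_const_mul _ (by fun_prop),
        ← lintegral_indicator measurableSet_Ioo]
      congr 1
      ext r
      by_cases hr : r ∈ Ioo 0 ‖ruled c n q‖⁻¹
      · rw [indicator_of_mem hr, indicator_of_mem (show (q, r) ∈ K' from ⟨hq, hr⟩)]
      · rw [indicator_of_notMem hr, indicator_of_notMem (fun h : (q, r) ∈ K' => hr h.2)]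
    · rw [indicator_of_notMem hq]
      have : ∀ r, K'.indicator g (q, r) = 0 := fun r =>
        indicator_of_notMem (fun h : (q, r) ∈ K' => hq h.1) g
      simp [this]
  rw [area, Measure.toSphere_apply' _ (measurableSet_patch_image hc hR hinj hdet), himg, hvol,
    ← lintegral_const_mul _ (by
      have h1 : Continuous fun q : ℝ × ℝ => |det3 (deriv c q.1) n (c q.1)| :=
        (hDc.comp continuous_fst).abs
      exact (h1.measurable.mul (((hrc.measurable.norm.inv).pow_const 3).div_const 3)).ennreal_ofReal)]
  congr 1
  ext q
  rw [show ((Module.finrank ℝ E3 : ℕ) : ENNReal) = ENNReal.ofReal 3 by simp,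
    ← ENNReal.ofReal_mul (by norm_num)]
  congr 1
  ring

/-- The surface measure in the coordinates of a patch. -/
lemma area_restrict_patch {c : ℝ → E3} (hc : ContDiff ℝ 1 c) {n : E3} {R : Set (ℝ × ℝ)}
    (hR : MeasurableSet R) (hinj : InjOn (patch c n) R)
    (hdet : ∀ q ∈ R, det3 (deriv c q.1) n (c q.1) ≠ 0) :
    area.restrict (patch c n '' R) = ((volume.restrict R).withDensity fun q =>
      ENNReal.ofReal (|det3 (deriv c q.1) n (c q.1)| * (‖ruled c n q‖⁻¹) ^ 3)).map
        (patch c n) := by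
  ext T hT
  have hm := measurable_patch hc.continuous n
  rw [Measure.restrict_apply hT, Measure.map_apply hm hT, withDensity_apply _ (hm hT),
    Measure.restrict_restrict (hm hT), inter_comm (patch c n ⁻¹' T), inter_comm T,
    ← image_inter_preimage]
  exact area_patch_image hc (hR.inter (hm hT)) (hinj.mono inter_subset_left)
    fun q hq => hdet q hq.1

/-! ### Green's formula on a rectangle -/

lemma setIntegral_partial_fst {a b t₀ t₁ : ℝ} (hab : a ≤ b) {A A' : ℝ × ℝ → ℝ}
    (hA' : ContinuousOn A' (Icc a b ×ˢ Icc t₀ t₁))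
    (dA : ∀ s ∈ Icc a b, ∀ t ∈ Icc t₀ t₁, HasDerivAt (fun s => A (s, t)) (A' (s, t)) s) :
    ∫ q in Icc a b ×ˢ Icc t₀ t₁, A' q = ∫ t in Icc t₀ t₁, (A (b, t) - A (a, t)) := by
  have hi : IntegrableOn A' (Icc a b ×ˢ Icc t₀ t₁) :=
    hA'.integrableOn_compact (isCompact_Icc.prod isCompact_Icc)
  rw [Measure.volume_eq_prod] at hi ⊢
  rw [setIntegral_prod _ hi]
  rw [IntegrableOn, ← Measure.prod_restrict] at hi
  rw [integral_integral_swap (f := fun s t => A' (s, t)) hi]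
  refine setIntegral_congr_fun measurableSet_Icc fun t ht => ?_
  have hc : ContinuousOn (fun s => A' (s, t)) (Icc a b) :=
    hA'.comp (by fun_prop) fun s hs => ⟨hs, ht⟩
  rw [integral_Icc_eq_integral_Ioc, ← intervalIntegral.integral_of_le hab]
  refine intervalIntegral.integral_eq_sub_of_hasDerivAt (f := fun s => A (s, t)) ?_ ?_
  · intro s hs
    rw [uIcc_of_le hab] at hs
    exact dA s hs t ht
  · exact hc.intervalIntegrable_of_Icc hab

lemma setIntegral_partial_snd {a b t₀ t₁ : ℝ} (ht : t₀ ≤ t₁) {B B' : ℝ × ℝ → ℝ}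
    (hB' : ContinuousOn B' (Icc a b ×ˢ Icc t₀ t₁))
    (dB : ∀ s ∈ Icc a b, ∀ t ∈ Icc t₀ t₁, HasDerivAt (fun t => B (s, t)) (B' (s, t)) t) :
    ∫ q in Icc a b ×ˢ Icc t₀ t₁, B' q = ∫ s in Icc a b, (B (s, t₁) - B (s, t₀)) := by
  have hi : IntegrableOn B' (Icc a b ×ˢ Icc t₀ t₁) :=
    hB'.integrableOn_compact (isCompact_Icc.prod isCompact_Icc)
  rw [Measure.volume_eq_prod] at hi ⊢
  rw [setIntegral_prod _ hi]
  refine setIntegral_congr_fun measurableSet_Icc fun s hs => ?_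
  have hc : ContinuousOn (fun t => B' (s, t)) (Icc t₀ t₁) :=
    hB'.comp (by fun_prop) fun t ht => ⟨hs, ht⟩
  rw [integral_Icc_eq_integral_Ioc, ← intervalIntegral.integral_of_le ht]
  refine intervalIntegral.integral_eq_sub_of_hasDerivAt (f := fun t => B (s, t)) ?_ ?_
  · intro t ht'
    rw [uIcc_of_le ht] at ht'
    exact dB s hs t ht'
  · exact hc.intervalIntegrable_of_Icc ht

/-- Green's formula on a rectangle for data that are differentiable only away from the lower side
and vanish on the other sides. -/
lemma setIntegral_curl_rectangle {a b t₀ t₁ : ℝ} (hab : a ≤ b) (ht : t₀ < t₁)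
    {A B A' B' : ℝ × ℝ → ℝ}
    (hB : ContinuousOn B (Icc a b ×ˢ Icc t₀ t₁))
    (hA' : ContinuousOn A' (Icc a b ×ˢ Ioc t₀ t₁))
    (hB' : ContinuousOn B' (Icc a b ×ˢ Ioc t₀ t₁))
    (dA : ∀ s ∈ Icc a b, ∀ t ∈ Ioc t₀ t₁, HasDerivAt (fun s => A (s, t)) (A' (s, t)) s)
    (dB : ∀ s ∈ Icc a b, ∀ t ∈ Ioc t₀ t₁, HasDerivAt (fun t => B (s, t)) (B' (s, t)) t)
    (hAa : ∀ t ∈ Ioc t₀ t₁, A (a, t) = 0) (hAb : ∀ t ∈ Ioc t₀ t₁, A (b, t) = 0)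
    (hBt : ∀ s ∈ Icc a b, B (s, t₁) = 0)
    (hint : IntegrableOn (fun q => A' q - B' q) (Icc a b ×ˢ Ioc t₀ t₁)) :
    ∫ q in Icc a b ×ˢ Ioc t₀ t₁, (A' q - B' q) = ∫ s in a..b, B (s, t₀) := by
  -- Above any level `e > t₀` both partial derivatives are continuous on a compact rectangle, so
  -- Fubini and the fundamental theorem of calculus apply.
  have key : ∀ e ∈ Ioo t₀ t₁, ∫ q in Icc a b ×ˢ Icc e t₁, (A' q - B' q) = ∫ s in a..b, B (s, e) := by
    intro e he
    have hsub : Icc e t₁ ⊆ Ioc t₀ t₁ := fun t h => ⟨he.1.trans_le h.1, h.2⟩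
    have hA'' := hA'.mono (prod_mono_right (s := Icc a b) hsub)
    have hB'' := hB'.mono (prod_mono_right (s := Icc a b) hsub)
    have hK : IsCompact (Icc a b ×ˢ Icc e t₁) := isCompact_Icc.prod isCompact_Icc
    have h1 : ∫ t in Icc e t₁, (A (b, t) - A (a, t)) = 0 := by
      rw [setIntegral_congr_fun (g := fun _ => (0 : ℝ)) measurableSet_Icc
        (fun t h => by simp [hAa t (hsub h), hAb t (hsub h)]), integral_zero]
    have h2 : ∫ s in Icc a b, (B (s, t₁) - B (s, e)) = ∫ s in Icc a b, -B (s, e) :=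
      setIntegral_congr_fun measurableSet_Icc (fun s h => by simp [hBt s h])
    rw [integral_sub (hA''.integrableOn_compact hK) (hB''.integrableOn_compact hK),
      setIntegral_partial_fst hab hA'' (fun s hs t h => dA s hs t (hsub h)),
      setIntegral_partial_snd he.2.le hB'' (fun s hs t h => dB s hs t (hsub h)),
      h1, h2, integral_neg, integral_Icc_eq_integral_Ioc, intervalIntegral.integral_of_le hab,
      zero_sub, neg_neg]
  obtain ⟨e, hanti, he, hlim⟩ := exists_seq_strictAnti_tendsto' ht
  have hU : ⋃ k, Icc a b ×ˢ Icc (e k) t₁ = Icc a b ×ˢ Ioc t₀ t₁ := by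
    rw [← prod_iUnion]
    congr 1
    ext t
    simp only [mem_iUnion, mem_Icc, mem_Ioc]
    constructor
    · rintro ⟨k, h1, h2⟩
      exact ⟨(he k).1.trans_le h1, h2⟩
    · rintro ⟨h1, h2⟩
      obtain ⟨k, hk⟩ := (hlim.eventually (gt_mem_nhds h1)).exists
      exact ⟨k, hk.le, h2⟩
  -- The exhaustion from above needs integrability of the difference `A' - B'` only, not of its two
  -- terms.
  have l1 : Tendsto (fun k => ∫ q in Icc a b ×ˢ Icc (e k) t₁, (A' q - B' q)) atTop
      (𝓝 (∫ q in Icc a b ×ˢ Ioc t₀ t₁, (A' q - B' q))) := by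
    rw [← hU] at hint ⊢
    refine tendsto_setIntegral_of_monotone (fun k => measurableSet_Icc.prod measurableSet_Icc)
      (fun i j hij => ?_) hint
    exact prod_mono_right (Icc_subset_Icc_left (hanti.antitone hij))
  have l2 : Tendsto (fun k => ∫ s in a..b, B (s, e k)) atTop (𝓝 (∫ s in a..b, B (s, t₀))) := by
    obtain ⟨C, hC⟩ := (isCompact_Icc.prod isCompact_Icc).exists_bound_of_continuousOn hB
    have hek : ∀ k, e k ∈ Icc t₀ t₁ := fun k => ⟨(he k).1.le, (he k).2.le⟩
    refine intervalIntegral.tendsto_integral_filter_of_dominated_convergence (fun _ => C) ?_ ?_ ?_ ?_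
    · refine Eventually.of_forall fun k => ?_
      rw [uIoc_of_le hab]
      have : ContinuousOn (fun s => B (s, e k)) (Icc a b) :=
        hB.comp (by fun_prop) fun s hs => ⟨hs, hek k⟩
      exact (this.mono Ioc_subset_Icc_self).aestronglyMeasurable measurableSet_Ioc
    · refine Eventually.of_forall fun k => Eventually.of_forall fun s hs => ?_
      rw [uIoc_of_le hab] at hs
      exact hC _ ⟨Ioc_subset_Icc_self hs, hek k⟩
    · simp
    · refine Eventually.of_forall fun s hs => ?_
      rw [uIoc_of_le hab] at hs
      have hs' := Ioc_subset_Icc_self hs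
      refine (hB (s, t₀) ⟨hs', left_mem_Icc.2 ht.le⟩).tendsto.comp ?_
      refine tendsto_nhdsWithin_iff.2 ⟨?_, Eventually.of_forall fun k => ⟨hs', hek k⟩⟩
      exact tendsto_const_nhds.prodMk_nhds hlim
  exact tendsto_nhds_unique l1 (l2.congr fun k => (key _ (he k)).symm)

/-! ### The divergence theorem on a patch -/

lemma HasDerivAt.det3 {p q r : ℝ → E3} {p' q' r' : E3} {s : ℝ} (hp : HasDerivAt p p' s)
    (hq : HasDerivAt q q' s) (hr : HasDerivAt r r' s) :
    HasDerivAt (fun s => SphereRepr.det3 (p s) (q s) (r s))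
      (SphereRepr.det3 p' (q s) (r s) + SphereRepr.det3 (p s) q' (r s) +
        SphereRepr.det3 (p s) (q s) r') s := by
  have hi : ∀ {g : ℝ → E3} {g' : E3}, HasDerivAt g g' s → ∀ i, HasDerivAt (fun s => g s i) (g' i) s :=
    fun {g g'} hg i => (EuclideanSpace.proj i : E3 →L[ℝ] ℝ).hasFDerivAt.comp_hasDerivAt s hg
  have h := (((hi hp 0).mul (((hi hq 1).mul (hi hr 2)).sub ((hi hq 2).mul (hi hr 1)))).add
    ((hi hp 1).mul (((hi hq 2).mul (hi hr 0)).sub ((hi hq 0).mul (hi hr 2))))).add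
    ((hi hp 2).mul (((hi hq 0).mul (hi hr 1)).sub ((hi hq 1).mul (hi hr 0))))
  refine h.congr_deriv ?_
  simp only [SphereRepr.det3, Pi.mul_apply, Pi.sub_apply]
  ring

lemma continuousOn_det3 {α : Type*} [TopologicalSpace α] {p q r : α → E3} {R : Set α}
    (hp : ContinuousOn p R) (hq : ContinuousOn q R) (hr : ContinuousOn r R) :
    ContinuousOn (fun s => det3 (p s) (q s) (r s)) R := by
  unfold det3
  fun_prop

lemma HasDerivAt.norm_inv {p : ℝ → E3} {p' : E3} {s : ℝ} (hp : HasDerivAt p p' s)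
    (h0 : p s ≠ 0) : HasDerivAt (fun s => ‖p s‖⁻¹) (-(‖p s‖⁻¹ ^ 3 * ⟪p s, p'⟫)) s := by
  have h1 := hp.norm_sq
  have hpos : 0 < ‖p s‖ := norm_pos_iff.2 h0
  have h2 := (h1.sqrt (by positivity)).inv (by positivity)
  simp only [Real.sqrt_sq (norm_nonneg _)] at h2
  refine (h2.congr_of_eventuallyEq ?_).congr_deriv ?_
  · exact Eventually.of_forall fun t => by simp
  · field_simp

lemma clm_apply_coord (M : E3 →L[ℝ] E3) (v : E3) (i : Fin 3) :
    (M v) i = ∑ j : Fin 3, v j * (M (EuclideanSpace.single j 1)) i := by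
  have hv : v = ∑ j : Fin 3, v j • (EuclideanSpace.single j 1 : E3) := by
    simpa using ((EuclideanSpace.basisFun (Fin 3) ℝ).sum_repr v).symm
  conv_lhs => rw [hv]
  simp [Fin.sum_univ_three]

/-- The trace is the derivative of the determinant at the identity; this is the linearised form of
multiplicativity. -/
lemma det3_trace (M : E3 →L[ℝ] E3) (a b c : E3) :
    det3 (M a) b c + det3 a (M b) c + det3 a b (M c) =
      (∑ i : Fin 3, (M (EuclideanSpace.single i 1)) i) * det3 a b c := by
  simp only [det3, clm_apply_coord M a, clm_apply_coord M b, clm_apply_coord M c,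
    Fin.sum_univ_three]
  ring

lemma inner_eq_coord (a b : E3) : ⟪a, b⟫ = a 0 * b 0 + a 1 * b 1 + a 2 * b 2 := by
  simp [PiLp.inner_apply, Fin.sum_univ_three]
  ring

/-- Cramer's rule gives the linear relation between the four vectors `F`, `n`, `c`, `X` of space;
this is its inner product with `X`. -/
lemma inner_mul_det3 (F n c X : E3) :
    ⟪X, c⟫ * det3 F n X - ⟪X, n⟫ * det3 F c X = ⟪X, X⟫ * det3 F n c - ⟪F, X⟫ * det3 n c X := by
  simp only [inner_eq_coord, det3]
  ring

/-- The pointwise form of the divergence theorem in the coordinates of a patch, for a tangential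
field that is homogeneous of degree `-1`. -/
lemma patch_divergence_identity (M : E3 →L[ℝ] E3) {F X : E3} (hX : X ≠ 0) (c n : E3)
    (hE : M X = -F) (hT : ⟪F, X⟫ = 0) :
    (-(‖X‖⁻¹ ^ 3 * ⟪X, c⟫) * det3 F n X + ‖X‖⁻¹ * (det3 (M c) n X + det3 F n c)) -
      (-(‖X‖⁻¹ ^ 3 * ⟪X, n⟫) * det3 F c X + ‖X‖⁻¹ * (det3 (M n) c X + det3 F c n)) =
      ‖X‖⁻¹ * det3 c n X * ∑ i : Fin 3, (M (EuclideanSpace.single i 1)) i := by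
  have h1 := det3_trace M c n X
  have h2 := inner_mul_det3 F n c X
  rw [hT, real_inner_self_eq_norm_sq] at h2
  rw [hE] at h1
  have h3 : det3 c (M n) X = -det3 (M n) c X := by simp only [det3]; ring
  have h4 : det3 c n (-F) = det3 F n c := by simp [det3]; ring
  have h5 : det3 F c n = -det3 F n c := by simp only [det3]; ring
  have hN : ‖X‖⁻¹ ^ 2 * ‖X‖ ^ 2 = 1 := by
    rw [← mul_pow, inv_mul_cancel₀ (norm_ne_zero_iff.2 hX), one_pow]
  rw [h3, h4] at h1
  rw [h5]
  -- The last determinants on the left add up to `2 det(F, n, c)`. The derivatives of `|X|⁻¹` remove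
  -- one copy, by Cramer's relation and tangency; the other is the Euler term in the trace identity.
  linear_combination ‖X‖⁻¹ * h1 - ‖X‖⁻¹ ^ 3 * h2 - ‖X‖⁻¹ * det3 F n c * hN

/-- The divergence theorem on a patch, for a field that vanishes on all sides but the lower one. -/
lemma setIntegral_surfDiv_patch {c : ℝ → E3} (hc : ContDiff ℝ 1 c) {n : E3} {a b t₀ t₁ : ℝ}
    (hab : a ≤ b) (ht : t₀ < t₁) (hdet : ∀ s ∈ Icc a b, 0 < det3 (deriv c s) n (c s))
    (hinj : InjOn (patch c n) (Icc a b ×ˢ Ioc t₀ t₁)) {S : Set Sph} (hSo : IsOpen S)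
    (hS : ∀ q ∈ Icc a b ×ˢ Ioc t₀ t₁, patch c n q ∈ S) {f : Sph → E3} (hf : IsDivField f S)
    (ha : ∀ t ∈ Ioc t₀ t₁, f (patch c n (a, t)) = 0)
    (hb : ∀ t ∈ Ioc t₀ t₁, f (patch c n (b, t)) = 0)
    (htop : ∀ s ∈ Icc a b, f (patch c n (s, t₁)) = 0) :
    ∫ x in patch c n '' (Icc a b ×ˢ Ioc t₀ t₁), surfDiv f x ∂area =
      ∫ s in a..b, ‖ruled c n (s, t₀)‖⁻¹ *
        det3 (extField f (ruled c n (s, t₀))) (deriv c s) (ruled c n (s, t₀)) := by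
  set R := Icc a b ×ˢ Ioc t₀ t₁ with hR
  have hRm : MeasurableSet R := measurableSet_Icc.prod measurableSet_Ioc
  set X := ruled c n with hX
  set F := extField f with hF
  have hXc : Continuous X := continuous_ruled hc.continuous n
  have hdc : Continuous (deriv c) := hc.continuous_deriv le_rfl
  have hX0 : ∀ q : ℝ × ℝ, q.1 ∈ Icc a b → X q ≠ 0 := fun q hq =>
    ruled_ne_zero (hdet q.1 hq).ne'
  have hcone : ∀ q ∈ R, X q ∈ cone S := fun q hq => ⟨hX0 q hq.1, hS q hq⟩
  have hpc : ∀ q : ℝ × ℝ, q.1 ∈ Icc a b → ContinuousAt (patch c n) q := fun q hq =>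
    (continuousAt_radial (hX0 q hq)).comp hXc.continuousAt
  -- By continuity the lower side lands in the closure of `S`, where `f` is still continuous. This
  -- makes `B` continuous on the closed rectangle although `B'` exists only above the lower side.
  have hclos : ∀ q ∈ Icc a b ×ˢ Icc t₀ t₁, patch c n q ∈ closure S := by
    intro q hq
    have h1 : q ∈ closure R := by
      rw [hR, closure_prod_eq, closure_Icc, closure_Ioc ht.ne]
      exact hq
    exact ((hpc q hq.1).continuousWithinAt (s := R)).mem_closure h1 hS
  have hFd : ∀ q ∈ R, HasFDerivAt F (fderiv ℝ F (X q)) (X q) := fun q hq =>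
    ((hf.contDiffOn.differentiableOn one_ne_zero).differentiableAt
      ((isOpen_cone hSo).mem_nhds (hcone q hq))).hasFDerivAt
  have hinvc : ContinuousOn (fun q => ‖X q‖⁻¹) (Icc a b ×ˢ Icc t₀ t₁) :=
    hXc.norm.continuousOn.inv₀ fun q hq => norm_ne_zero_iff.2 (hX0 q hq.1)
  have hsub : R ⊆ Icc a b ×ˢ Icc t₀ t₁ := prod_mono_right Ioc_subset_Icc_self
  have hFc : ContinuousOn (fun q => F (X q)) (Icc a b ×ˢ Icc t₀ t₁) := by
    refine hinvc.smul (hf.continuousOn.comp (f := patch c n) ?_ hclos)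
    exact fun q hq => (hpc q hq.1).continuousWithinAt
  have hDFc : ContinuousOn (fun q => fderiv ℝ F (X q)) R :=
    (hf.contDiffOn.continuousOn_fderiv_of_isOpen (isOpen_cone hSo) le_rfl).comp
      hXc.continuousOn hcone
  have hcs : ∀ s t, HasDerivAt (fun s => X (s, t)) (deriv c s) s := fun s t => by
    simpa [hX, ruled] using ((hc.differentiable one_ne_zero s).hasDerivAt.add_const (t • n))
  have hct : ∀ s t, HasDerivAt (fun t => X (s, t)) n t := fun s t => by
    simpa [hX, ruled] using ((hasDerivAt_id t).smul_const n).const_add (c s)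
  -- `A` is differentiated in `s` and contains `c` but not `c'`; `B` contains `c'(s)` but is
  -- differentiated in `τ`. Hence `c` need only be of class `C¹`.
  set A : ℝ × ℝ → ℝ := fun q => ‖X q‖⁻¹ * det3 (F (X q)) n (X q) with hA
  set B : ℝ × ℝ → ℝ := fun q => ‖X q‖⁻¹ * det3 (F (X q)) (deriv c q.1) (X q) with hB
  set A' : ℝ × ℝ → ℝ := fun q =>
    -(‖X q‖⁻¹ ^ 3 * ⟪X q, deriv c q.1⟫) * det3 (F (X q)) n (X q) + ‖X q‖⁻¹ *
      (det3 (fderiv ℝ F (X q) (deriv c q.1)) n (X q) + det3 (F (X q)) n (deriv c q.1)) with hA'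
  set B' : ℝ × ℝ → ℝ := fun q =>
    -(‖X q‖⁻¹ ^ 3 * ⟪X q, n⟫) * det3 (F (X q)) (deriv c q.1) (X q) + ‖X q‖⁻¹ *
      (det3 (fderiv ℝ F (X q) n) (deriv c q.1) (X q) + det3 (F (X q)) (deriv c q.1) n) with hB'
  have hdet0 : ∀ x y z : E3, det3 x 0 z = 0 ∧ det3 0 y z = 0 := fun x y z => by simp [det3]
  have hd1 : ContinuousOn (fun q : ℝ × ℝ => deriv c q.1) R :=
    (hdc.comp continuous_fst).continuousOn
  have hFc' := hFc.mono hsub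
  have hinvc' := hinvc.mono hsub
  have hA'c : ContinuousOn A' R := by
    refine ContinuousOn.add (ContinuousOn.mul ?_ (continuousOn_det3 hFc' continuousOn_const
      hXc.continuousOn)) (hinvc'.mul (ContinuousOn.add (continuousOn_det3 (hDFc.clm_apply hd1)
      continuousOn_const hXc.continuousOn) (continuousOn_det3 hFc' continuousOn_const hd1)))
    exact ((hinvc'.pow 3).mul (hXc.continuousOn.inner (𝕜 := ℝ) hd1)).neg
  have hB'c : ContinuousOn B' R := by
    refine ContinuousOn.add (ContinuousOn.mul ?_ (continuousOn_det3 hFc' hd1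
      hXc.continuousOn)) (hinvc'.mul (ContinuousOn.add (continuousOn_det3
      (hDFc.clm_apply continuousOn_const) hd1 hXc.continuousOn)
      (continuousOn_det3 hFc' hd1 continuousOn_const)))
    exact ((hinvc'.pow 3).mul (hXc.continuousOn.inner (𝕜 := ℝ) continuousOn_const)).neg
  have hBc : ContinuousOn B (Icc a b ×ˢ Icc t₀ t₁) :=
    hinvc.mul (continuousOn_det3 hFc (hdc.comp continuous_fst).continuousOn hXc.continuousOn)
  have dA : ∀ s ∈ Icc a b, ∀ t ∈ Ioc t₀ t₁, HasDerivAt (fun s => A (s, t)) (A' (s, t)) s := by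
    intro s hs t ht'
    have h1 := HasDerivAt.norm_inv (hcs s t) (hX0 (s, t) hs)
    have h2 : HasDerivAt (fun s => F (X (s, t))) (fderiv ℝ F (X (s, t)) (deriv c s)) s :=
      HasFDerivAt.comp_hasDerivAt (l := F) (f := fun s => X (s, t)) s (hFd (s, t) ⟨hs, ht'⟩) (hcs s t)
    refine (h1.mul (HasDerivAt.det3 h2 (hasDerivAt_const s n) (hcs s t))).congr_deriv ?_
    simp only [hA', (hdet0 _ 0 _).1, add_zero]
  have dB : ∀ s ∈ Icc a b, ∀ t ∈ Ioc t₀ t₁, HasDerivAt (fun t => B (s, t)) (B' (s, t)) t := by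
    intro s hs t ht'
    have h1 := HasDerivAt.norm_inv (hct s t) (hX0 (s, t) hs)
    have h2 : HasDerivAt (fun t => F (X (s, t))) (fderiv ℝ F (X (s, t)) n) t :=
      HasFDerivAt.comp_hasDerivAt (l := F) (f := fun t => X (s, t)) t (hFd (s, t) ⟨hs, ht'⟩) (hct s t)
    refine (h1.mul (HasDerivAt.det3 h2 (hasDerivAt_const t (deriv c s)) (hct s t))).congr_deriv ?_
    simp only [hB', (hdet0 _ 0 _).1, add_zero]
  have hF0 : ∀ q, f (patch c n q) = 0 → F (X q) = 0 := fun q hq => by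
    change ‖X q‖⁻¹ • f (patch c n q) = 0
    rw [hq, smul_zero]
  have hAz : ∀ q, f (patch c n q) = 0 → A q = 0 := fun q hq => by
    simp only [hA, hF0 q hq, (hdet0 0 _ _).2, mul_zero]
  have hBz : ∀ q, f (patch c n q) = 0 → B q = 0 := fun q hq => by
    simp only [hB, hF0 q hq, (hdet0 0 _ _).2, mul_zero]
  set ρ : ℝ × ℝ → ℝ := fun q => |det3 (deriv c q.1) n (c q.1)| * (‖X q‖⁻¹) ^ 3 with hρ
  have hρ0 : ∀ q, 0 ≤ ρ q := fun q => by positivity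
  have hρm : Measurable fun q => ENNReal.ofReal (ρ q) := by
    have h1 : Continuous fun s => det3 (deriv c s) n (c s) := by
      rw [← continuousOn_univ]
      exact continuousOn_det3 hdc.continuousOn continuousOn_const hc.continuous.continuousOn
    exact ((h1.comp continuous_fst).abs.measurable.mul
      (hXc.measurable.norm.inv.pow_const 3)).ennreal_ofReal
  have hid : ∀ q ∈ R, ρ q * surfDiv f (patch c n q) = A' q - B' q := by
    intro q hq
    have hq0 := hX0 q hq.1
    have hT : ⟪F (X q), X q⟫ = 0 := by
      have := hf.tangent _ (hS q hq)
      rw [← norm_smul_radial hq0]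
      change ⟪F _, ‖X q‖ • (patch c n q : E3)⟫ = 0
      rw [norm_smul_radial hq0]
      change ⟪‖X q‖⁻¹ • f (patch c n q), _⟫ = 0
      rw [real_inner_smul_left, real_inner_smul_right, this]
      simp
    have h1 := patch_divergence_identity (fderiv ℝ F (X q)) hq0 (deriv c q.1) n
      (fderiv_extField_self hq0 (hFd q hq).differentiableAt) hT
    change A' q - B' q = _ * divE F (X q) at h1
    rw [h1, divE_extField hq0]
    change _ = _ * (_ * surfDiv f (patch c n q))
    have h2 : det3 (deriv c q.1) n (X q) = det3 (deriv c q.1) n (c q.1) := det3_add_smul _ _ _ _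
    rw [h2, hρ]
    simp only
    rw [abs_of_pos (hdet q.1 hq.1)]
    ring
  have hmap := area_restrict_patch hc (n := n) hRm hinj fun q hq => (hdet q.1 hq.1).ne'
  have hpm := measurable_patch hc.continuous n
  have hint : Integrable (surfDiv f) (area.restrict (patch c n '' R)) :=
    hf.integrable.mono_set (image_subset_iff.2 hS)
  rw [hmap] at hint
  have hint2 := (integrable_map_measure hint.aestronglyMeasurable hpm.aemeasurable).1 hint
  rw [integrable_withDensity_iff_integrable_smul' hρm
    (Eventually.of_forall fun _ => ENNReal.ofReal_lt_top)] at hint2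
  have hto : ∀ q, (ENNReal.ofReal (ρ q)).toReal = ρ q := fun q => ENNReal.toReal_ofReal (hρ0 q)
  have hint3 : IntegrableOn (fun q => A' q - B' q) R := by
    refine (integrableOn_congr_fun (fun q hq => ?_) hRm).1 hint2
    rw [hto, smul_eq_mul]
    exact hid q hq
  rw [hmap, integral_map hpm.aemeasurable hint.aestronglyMeasurable,
    integral_withDensity_eq_integral_toReal_smul hρm
    (Eventually.of_forall fun _ => ENNReal.ofReal_lt_top)]
  rw [setIntegral_congr_fun (g := fun q => A' q - B' q) hRm (fun q hq => by
    simp only [hto, smul_eq_mul]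
    exact hid q hq)]
  exact setIntegral_curl_rectangle hab ht hBc hA'c hB'c dA dB (fun t h => hAz _ (ha t h))
    (fun t h => hAz _ (hb t h)) (fun s h => hBz _ (htop s h)) hint3

/-! ### Local form of the divergence theorem -/

/-- A ruled surface that is transversal to the radial direction gives local coordinates of the
sphere. -/
lemma exists_patch_nhds {c : ℝ → E3} (hc : ContDiff ℝ 1 c) {n : E3} {s₀ : ℝ}
    (hD : 0 < det3 (deriv c s₀) n (c s₀)) :
    ∃ N ∈ 𝓝 ((s₀, 0) : ℝ × ℝ), InjOn (patch c n) N ∧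
      (∀ q ∈ N, 0 < det3 (deriv c q.1) n (c q.1)) ∧
      ∀ O ⊆ N, IsOpen O → IsOpen (patch c n '' O) := by
  have hXc := continuous_ruled hc.continuous n
  have hdc : Continuous (deriv c) := hc.continuous_deriv le_rfl
  have h0 : ruled c n (s₀, 0) ≠ 0 := ruled_ne_zero hD.ne'
  -- The third coordinate is the radius at which `polarMap` meets the unit sphere, so `polarMap ∘ j`
  -- is the patch and the inverse function theorem for `polarMap` can be used.
  set j : ℝ × ℝ → E3 := fun q => WithLp.toLp 2 ![q.1, q.2, ‖ruled c n q‖⁻¹] with hj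
  set k₀ := j (s₀, 0) with hk₀
  have hjc : ContinuousAt j (s₀, 0) := by
    refine (PiLp.continuous_toLp 2 _).continuousAt.comp ?_
    refine continuousAt_pi.2 fun i => ?_
    fin_cases i
    · exact continuous_fst.continuousAt
    · exact continuous_snd.continuousAt
    · exact hXc.continuousAt.norm.inv₀ (norm_ne_zero_iff.2 h0)
  have hdet0 : (polarDeriv c n k₀).det ≠ 0 := by
    rw [det_polarDeriv]
    refine mul_ne_zero (pow_ne_zero _ ?_) hD.ne'
    simpa [hk₀, hj] using h0
  have hstrict : HasStrictFDerivAt (polarMap c n)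
      ((polarDeriv c n k₀).toContinuousLinearEquivOfDetNeZero hdet0 : E3 →L[ℝ] E3) k₀ := by
    rw [ContinuousLinearMap.coe_toContinuousLinearEquivOfDetNeZero]
    exact (contDiff_polarMap hc n).contDiffAt.hasStrictFDerivAt' (hasFDerivAt_polarMap hc n k₀)
      one_ne_zero
  set e := hstrict.toOpenPartialHomeomorph (polarMap c n) with he
  have hek : k₀ ∈ e.source := hstrict.mem_toOpenPartialHomeomorph_source
  have hecoe : ∀ k, e k = polarMap c n k := fun k => rfl
  have hN1 : j ⁻¹' e.source ∈ 𝓝 ((s₀, 0) : ℝ × ℝ) :=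
    hjc.preimage_mem_nhds (e.open_source.mem_nhds hek)
  have hN2 : {q : ℝ × ℝ | 0 < det3 (deriv c q.1) n (c q.1)} ∈ 𝓝 ((s₀, 0) : ℝ × ℝ) := by
    have h1 : Continuous fun s => det3 (deriv c s) n (c s) := by
      rw [← continuousOn_univ]
      exact continuousOn_det3 hdc.continuousOn continuousOn_const hc.continuous.continuousOn
    exact (isOpen_lt continuous_const (h1.comp continuous_fst)).mem_nhds hD
  have hcoe : ∀ q : ℝ × ℝ, 0 < det3 (deriv c q.1) n (c q.1) →
      (patch c n q : E3) = polarMap c n (j q) := by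
    intro q hq
    rw [patch, coe_radial (ruled_ne_zero hq.ne')]
    rfl
  refine ⟨_, inter_mem hN1 hN2, ?_, fun q hq => hq.2, ?_⟩
  · intro q hq q' hq' h
    have h1 : e (j q) = e (j q') := by
      rw [hecoe, hecoe, ← hcoe q hq.2, ← hcoe q' hq'.2, h]
    have h2 := e.injOn hq.1 hq'.1 h1
    have h3 := congrArg (fun k : E3 => k 0) h2
    have h4 := congrArg (fun k : E3 => k 1) h2
    exact Prod.ext (by simpa [hj] using h3) (by simpa [hj] using h4)
  · intro O hON hO
    -- The radius is left free: the projection to the sphere forgets it, so an open set in space can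
    -- be cut with the sphere.
    set W : Set E3 := {k | k ∈ e.source ∧ ((k 0, k 1) ∈ O ∧ 0 < k 2)} with hW
    have hWo : IsOpen W := by
      have h1 : Continuous fun k : E3 => (k 0, k 1) := by fun_prop
      have h2 : Continuous fun k : E3 => k 2 := by fun_prop
      exact e.open_source.inter ((hO.preimage h1).inter (isOpen_lt continuous_const h2))
    have hWi : IsOpen (e '' W) := e.isOpen_image_of_subset_source hWo fun k hk => hk.1
    have heq : patch c n '' O = (Subtype.val : Sph → E3) ⁻¹' (e '' W) := by
      ext x
      constructor
      · rintro ⟨q, hq, rfl⟩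
        refine ⟨j q, ⟨(hON hq).1, by simpa [hj] using hq, ?_⟩, ?_⟩
        · simpa [hj] using ruled_ne_zero (hON hq).2.ne'
        · rw [hecoe, ← hcoe q (hON hq).2]
      · rintro ⟨k, ⟨-, hk2, hk3⟩, hk⟩
        refine ⟨_, hk2, ?_⟩
        have h1 : (x : E3) = k 2 • ruled c n (k 0, k 1) := hk.symm
        rw [← radial_coe x, h1, radial_smul hk3 (ruled_ne_zero (hON hk2).2.ne')]
        rfl
    rw [heq]
    exact hWi.preimage continuous_subtype_val

lemma exists_closedBox_subset {s₀ : ℝ} {N : Set (ℝ × ℝ)} (hN : N ∈ 𝓝 ((s₀, 0) : ℝ × ℝ)) :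
    ∃ δ > 0, Icc (s₀ - δ) (s₀ + δ) ×ˢ Icc (-δ) δ ⊆ N := by
  obtain ⟨δ, hδ, h⟩ := Metric.nhds_basis_closedBall.mem_iff.1 hN
  refine ⟨δ, hδ, ?_⟩
  rw [← closedBall_prod_same, Real.closedBall_eq_Icc, Real.closedBall_eq_Icc] at h
  simpa using h

lemma surfDiv_eq_zero_of_notMem_tsupport {f : Sph → E3} {x : Sph} (hx : x ∉ tsupport f) :
    surfDiv f x = 0 := by
  have h1 : f =ᶠ[𝓝 x] 0 := notMem_tsupport_iff_eventuallyEq.1 hx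
  have h2 : extField f =ᶠ[𝓝 (x : E3)] fun _ => 0 := by
    have h3 : Tendsto radial (𝓝 (x : E3)) (𝓝 x) := by
      have := (continuousAt_radial (coe_sph_ne_zero x)).tendsto
      rwa [radial_coe] at this
    filter_upwards [h3.eventually h1] with y hy
    simp [extField, hy]
  simp [surfDiv, divE, h2.fderiv_eq]

/-- Lagrange's identity. For orthogonal unit vectors the value is 1, which supplies the
transversality required of a patch. -/
lemma det3_cross (e p : E3) : det3 e (cross p e) p = ‖e‖ ^ 2 * ‖p‖ ^ 2 - ⟪p, e⟫ ^ 2 := by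
  rw [← real_inner_self_eq_norm_sq, ← real_inner_self_eq_norm_sq]
  simp only [inner_eq_coord, det3, cross, cross_apply]
  simp
  ring

lemma exists_orthogonal_unit (p : E3) : ∃ e : E3, ‖e‖ = 1 ∧ ⟪p, e⟫ = 0 := by
  have h : Module.finrank ℝ (ℝ ∙ p)ᗮ ≠ 0 := by
    have h1 := Submodule.finrank_add_finrank_orthogonal (ℝ ∙ p)
    have h2 : Module.finrank ℝ (ℝ ∙ p) ≤ 1 := by
      simpa using finrank_span_le_card (R := ℝ) ({p} : Set E3)
    have h3 : Module.finrank ℝ E3 = 3 := by simp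
    omega
  have : Nontrivial (ℝ ∙ p)ᗮ := Module.nontrivial_of_finrank_pos (Nat.pos_of_ne_zero h)
  obtain ⟨v, hv⟩ := exists_ne (0 : (ℝ ∙ p)ᗮ)
  have hv0 : (v : E3) ≠ 0 := fun h => hv (Subtype.ext h)
  refine ⟨‖(v : E3)‖⁻¹ • (v : E3), by simp [norm_smul, hv0], ?_⟩
  rw [real_inner_smul_right, Submodule.mem_orthogonal_singleton_iff_inner_right.1 v.2, mul_zero]

/-- Near an interior point the integral of the divergence vanishes. -/
lemma exists_nhds_integral_surfDiv_eq_zero {S : Set Sph} (hSo : IsOpen S) {p : Sph} (hp : p ∈ S) :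
    ∃ W ⊆ S, IsOpen W ∧ p ∈ W ∧ ∀ f : Sph → E3, IsDivField f S → tsupport f ⊆ W →
      ∫ x in S, surfDiv f x ∂area = 0 := by
  obtain ⟨e, he1, he2⟩ := exists_orthogonal_unit p
  set n := cross (p : E3) e with hn
  -- The ruled surface is the tangent plane at `p`.
  set c : ℝ → E3 := fun s => p + s • e with hcdef
  have hc : ContDiff ℝ 1 c := contDiff_const.add (contDiff_id.smul contDiff_const)
  have hdc : deriv c 0 = e := by
    have : HasDerivAt c e 0 := by
      have h1 : HasDerivAt (fun s : ℝ => s • e) e 0 := by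
        simpa using (hasDerivAt_id (0 : ℝ)).smul_const e
      exact h1.const_add (p : E3)
    exact this.deriv
  have hc0 : c 0 = p := by simp [hcdef]
  have hD : 0 < det3 (deriv c 0) n (c 0) := by
    rw [hdc, hc0, hn, det3_cross, he1, he2, norm_coe_sph]
    norm_num
  obtain ⟨N, hN, hinj, hdet, hopen⟩ := exists_patch_nhds hc hD
  have hp0 : patch c n (0, 0) = p := by
    simp [patch, ruled, hc0, radial_coe]
  have hpc : ContinuousAt (patch c n) (0, 0) :=
    (continuousAt_radial (ruled_ne_zero hD.ne')).comp
      (continuous_ruled hc.continuous n).continuousAt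
  have hNS : patch c n ⁻¹' S ∈ 𝓝 ((0, 0) : ℝ × ℝ) :=
    hpc.preimage_mem_nhds (by rw [hp0]; exact hSo.mem_nhds hp)
  obtain ⟨δ, hδ, hbox⟩ := exists_closedBox_subset (inter_mem hN hNS)
  simp only [zero_sub, zero_add] at hbox
  have hIoo : Ioo (-δ) δ ×ˢ Ioo (-δ) δ ⊆ Icc (-δ) δ ×ˢ Icc (-δ) δ :=
    prod_mono Ioo_subset_Icc_self Ioo_subset_Icc_self
  set W := patch c n '' (Ioo (-δ) δ ×ˢ Ioo (-δ) δ) with hW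
  have hWS : W ⊆ S := by
    rintro _ ⟨q, hq, rfl⟩
    exact (hbox (hIoo hq)).2
  refine ⟨W, hWS, hopen _ (fun q hq => (hbox (hIoo hq)).1) (isOpen_Ioo.prod isOpen_Ioo), ?_, ?_⟩
  · refine ⟨(0, 0), ?_, hp0⟩
    simp [hδ]
  · intro f hf hfW
    have hzero : ∀ q ∈ Icc (-δ) δ ×ˢ Icc (-δ) δ, q ∉ Ioo (-δ) δ ×ˢ Ioo (-δ) δ →
        f (patch c n q) = 0 := by
      intro q hq hq'
      apply image_eq_zero_of_notMem_tsupport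
      intro h
      obtain ⟨q₁, hq₁, h1⟩ := hfW h
      exact hq' (hinj (hbox hq).1 (hbox (hIoo hq₁)).1 h1.symm ▸ hq₁)
    have hsub : Icc (-δ) δ ×ˢ Ioc (-δ) δ ⊆ Icc (-δ) δ ×ˢ Icc (-δ) δ :=
      prod_mono_right Ioc_subset_Icc_self
    have hδ' : -δ < δ := by linarith
    have key := setIntegral_surfDiv_patch hc (n := n) (a := -δ) (b := δ) (t₀ := -δ) (t₁ := δ)
      hδ'.le hδ' (fun s hs => hdet (s, δ) (hbox ⟨hs, right_mem_Icc.2 hδ'.le⟩).1)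
      (fun q hq q' hq' h => hinj (hbox (hsub hq)).1 (hbox (hsub hq')).1 h) hSo
      (fun q hq => (hbox (hsub hq)).2) hf
      (fun t ht => hzero _ (hsub ⟨left_mem_Icc.2 hδ'.le, ht⟩) (by simp))
      (fun t ht => hzero _ (hsub ⟨right_mem_Icc.2 hδ'.le, ht⟩) (by simp))
      (fun s hs => hzero _ ⟨hs, right_mem_Icc.2 hδ'.le⟩ (by simp))
    rw [setIntegral_eq_of_subset_of_forall_sdiff_eq_zero hSo.measurableSet
      (s := patch c n '' (Icc (-δ) δ ×ˢ Ioc (-δ) δ)), key]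
    · rw [intervalIntegral.integral_congr (g := fun _ => (0 : ℝ)), intervalIntegral.integral_zero]
      intro s hs
      rw [uIcc_of_le hδ'.le] at hs
      have h0 : extField f (ruled c n (s, -δ)) = 0 := by
        change _ • f (patch c n (s, -δ)) = 0
        rw [hzero (s, -δ) ⟨hs, left_mem_Icc.2 hδ'.le⟩ (by simp), smul_zero]
      simp [h0, det3]
    · rintro _ ⟨q, hq, rfl⟩
      exact (hbox (hsub hq)).2
    · intro x hx
      apply surfDiv_eq_zero_of_notMem_tsupport
      intro h
      obtain ⟨q, hq, h1⟩ := hfW h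
      exact hx.2 ⟨q, ⟨Ioo_subset_Icc_self hq.1, Ioo_subset_Ioc_self hq.2⟩, h1⟩

/-! ### The divergence theorem near a boundary point -/

lemma IsSimpleClosedCurve.map_toIcoMod {γ : ℝ → Sph} {L : ℝ} (hγ : IsSimpleClosedCurve γ L)
    (a s : ℝ) : γ (toIcoMod hγ.pos a s) = γ s := by
  rw [toIcoMod, hγ.periodic.sub_zsmul_eq]

lemma IsSimpleClosedCurve.eq_add_of_eq {γ : ℝ → Sph} {L : ℝ} (hγ : IsSimpleClosedCurve γ L)
    {s s' : ℝ} (h : γ s = γ s') : ∃ k : ℤ, s - s' = k * L := by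
  have h1 : γ (toIcoMod hγ.pos 0 s) = γ (toIcoMod hγ.pos 0 s') := by
    rw [hγ.map_toIcoMod, hγ.map_toIcoMod, h]
  have hm : ∀ s, toIcoMod hγ.pos 0 s ∈ Ico 0 L := fun s => by
    simpa using toIcoMod_mem_Ico hγ.pos 0 s
  have h2 := hγ.injOn (hm s) (hm s') h1
  have h3 := toIcoMod_add_toIcoDiv_zsmul hγ.pos 0 s
  have h4 := toIcoMod_add_toIcoDiv_zsmul hγ.pos 0 s'
  refine ⟨toIcoDiv hγ.pos 0 s - toIcoDiv hγ.pos 0 s', ?_⟩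
  simp only [zsmul_eq_mul] at h3 h4
  push_cast
  linarith

lemma IsSimpleClosedCurve.eq_of_eq {γ : ℝ → Sph} {L : ℝ} (hγ : IsSimpleClosedCurve γ L)
    {s s' : ℝ} (h : γ s = γ s') (hs : |s - s'| < L) : s = s' := by
  obtain ⟨k, hk⟩ := hγ.eq_add_of_eq h
  rw [hk, abs_mul, abs_of_pos hγ.pos] at hs
  have h1 : |(k : ℝ)| < 1 := by
    by_contra hcon
    nlinarith [hγ.pos]
  have h2 : k = 0 := by
    rw [← Int.cast_abs] at h1
    exact Int.abs_lt_one_iff.1 (by exact_mod_cast h1)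
  rw [h2] at hk
  simp at hk
  linarith

lemma IsSimpleClosedCurve.continuous {γ : ℝ → Sph} {L : ℝ} (hγ : IsSimpleClosedCurve γ L) :
    Continuous γ := continuous_induced_rng.2 hγ.contDiff.continuous

lemma IsSimpleClosedCurve.periodic_velocity {γ : ℝ → Sph} {L : ℝ} (hγ : IsSimpleClosedCurve γ L) :
    Function.Periodic (velocity γ) L := by
  intro s
  unfold velocity
  rw [← deriv_comp_add_const]
  congr 1
  ext1 r
  rw [hγ.periodic r]

lemma inner_velocity {γ : ℝ → Sph} (hγ : ContDiff ℝ 1 (fun s => (γ s : E3))) (s : ℝ) :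
    ⟪(γ s : E3), velocity γ s⟫ = 0 := by
  have h1 := (hγ.differentiable one_ne_zero s).hasDerivAt.norm_sq
  have h2 : (fun s => ‖(γ s : E3)‖ ^ 2) = fun _ => (1 : ℝ) := by
    ext1 s
    rw [norm_coe_sph]
    norm_num
  rw [h2] at h1
  have := h1.unique (hasDerivAt_const s (1 : ℝ))
  unfold velocity
  linarith

/-- In the patch built on `γ` and the fixed vector `n = e_r × t` at `s₀`, the curve is `τ = 0`, `S₂`
is the side `τ > 0`, and the side `τ < 0` misses `S₂`. Green's formula on the upper half then leaves
only the contribution of the lower side, which is the outward flux through the curve. -/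
lemma exists_nhds_integral_surfDiv_eq_lineIntegral {γ : ℝ → Sph} {L : ℝ} {S₁ S₂ : Set Sph}
    (hγ : IsSimpleClosedCurve γ L) (hS : Divides γ S₁ S₂) (hor : PositivelyOriented γ S₂)
    (s₀ : ℝ) :
    ∃ W, IsOpen W ∧ γ s₀ ∈ W ∧ ∀ f : Sph → E3, IsDivField f S₂ → tsupport f ⊆ W →
      ∫ x in S₂, surfDiv f x ∂area =
        ∫ s in (0 : ℝ)..L, det3 (f (γ s)) (velocity γ s) (γ s) := by
  have hL := hγ.pos
  set c : ℝ → E3 := fun s => (γ s : E3) with hcdef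
  have hc : ContDiff ℝ 1 c := hγ.contDiff
  have hdc : deriv c = velocity γ := rfl
  set n := cross (γ s₀ : E3) (unitTangent γ s₀) with hn
  have hv0 : 0 < ‖velocity γ s₀‖ := norm_pos_iff.2 (hγ.velocity_ne_zero s₀)
  have hD : 0 < det3 (deriv c s₀) n (c s₀) := by
    have h1 : det3 (velocity γ s₀) n (γ s₀) =
        ‖velocity γ s₀‖ * det3 (unitTangent γ s₀) n (γ s₀) := by
      simp only [det3, unitTangent, PiLp.smul_apply, smul_eq_mul]
      field_simp
    have h2 : ‖unitTangent γ s₀‖ = 1 := by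
      simp [unitTangent, norm_smul, hv0.ne']
    have h3 : ⟪(γ s₀ : E3), unitTangent γ s₀⟫ = 0 := by
      rw [unitTangent, real_inner_smul_right, inner_velocity hc, mul_zero]
    change 0 < det3 (velocity γ s₀) n (γ s₀)
    rw [h1, hn, det3_cross, h2, h3, norm_coe_sph]
    simpa using hγ.velocity_ne_zero s₀
  obtain ⟨N, hN, hinj, hdet, hopen⟩ := exists_patch_nhds hc hD
  have hp0 : ∀ s, patch c n (s, 0) = γ s := fun s => by
    simp [patch, ruled, hcdef, radial_coe]
  have hpc : ∀ q : ℝ × ℝ, 0 < det3 (deriv c q.1) n (c q.1) → ContinuousAt (patch c n) q :=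
    fun q hq => (continuousAt_radial (ruled_ne_zero hq.ne')).comp
      (continuous_ruled hc.continuous n).continuousAt
  obtain ⟨δ₁, hδ₁, hbox₁⟩ := exists_closedBox_subset hN
  -- The part of the curve with parameters away from `s₀`: a compact set that misses `γ s₀`, and
  -- hence a whole neighbourhood of it.
  set K : Set Sph := γ '' Icc (s₀ + δ₁) (s₀ - δ₁ + L) with hK
  have hKc : IsClosed K := (isCompact_Icc.image hγ.continuous).isClosed
  have hpK : γ s₀ ∉ K := by
    rintro ⟨s, hs, h⟩
    have := hγ.eq_of_eq h (by rw [abs_lt]; constructor <;> linarith [hs.1, hs.2])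
    linarith [hs.1]
  have hNK : patch c n ⁻¹' Kᶜ ∈ 𝓝 ((s₀, 0) : ℝ × ℝ) :=
    (hpc (s₀, 0) hD).preimage_mem_nhds (by rw [hp0]; exact hKc.isOpen_compl.mem_nhds hpK)
  obtain ⟨δ₂, hδ₂, hbox₂⟩ := exists_closedBox_subset (inter_mem hN hNK)
  -- The bound `L / 2` fits the parameter interval into a single period centred at `s₀`.
  set δ := min δ₂ (L / 2) with hδdef
  have hδ : 0 < δ := lt_min hδ₂ (by linarith)
  have hδ2 : δ ≤ δ₂ := min_le_left _ _
  have hδL : δ ≤ L / 2 := min_le_right _ _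
  have hbox : Icc (s₀ - δ) (s₀ + δ) ×ˢ Icc (-δ) δ ⊆ N ∩ patch c n ⁻¹' Kᶜ :=
    (Set.prod_mono (Icc_subset_Icc (by linarith) (by linarith))
      (Icc_subset_Icc (by linarith) hδ2)).trans hbox₂
  set Q := Ioo (s₀ - δ) (s₀ + δ) ×ˢ Ioo (-δ) δ with hQ
  have hIoo : Q ⊆ Icc (s₀ - δ) (s₀ + δ) ×ˢ Icc (-δ) δ :=
    prod_mono Ioo_subset_Icc_self Ioo_subset_Icc_self
  -- A point of the curve in the small box avoids `K`, so its parameter can be chosen within `δ₁` of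
  -- `s₀`; injectivity of the patch on the larger box then forces `τ = 0`.
  have hcurve : ∀ q ∈ Icc (s₀ - δ) (s₀ + δ) ×ˢ Icc (-δ) δ, patch c n q ∈ range γ → q.2 = 0 := by
    rintro q hq ⟨s, hs⟩
    set s' := toIcoMod hL (s₀ - δ₁) s with hs'
    have h1 : γ s' = patch c n q := by rw [hs', hγ.map_toIcoMod, hs]
    have h2 : s' ∈ Ico (s₀ - δ₁) (s₀ - δ₁ + L) := toIcoMod_mem_Ico hL _ _
    have h3 : s' < s₀ + δ₁ := by
      by_contra hcon
      exact (hbox hq).2 ⟨s', ⟨not_lt.1 hcon, h2.2.le⟩, h1⟩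
    rw [← hp0 s'] at h1
    have h4 := hinj (hbox₁ ⟨⟨h2.1, h3.le⟩, by simp [hδ₁.le]⟩) (hbox hq).1 h1
    rw [← h4]
  set W := patch c n '' Q with hW
  have hWo : IsOpen W := hopen _ (fun q hq => (hbox (hIoo hq)).1) (isOpen_Ioo.prod isOpen_Ioo)
  have hpW : γ s₀ ∈ W := ⟨(s₀, 0), by simp [hQ, hδ], hp0 s₀⟩
  have hnot1 : ∀ s, γ s ∉ S₁ := fun s h => by
    have : γ s ∈ (range γ)ᶜ := hS.union ▸ Or.inl h
    exact this ⟨s, rfl⟩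
  have hnot2 : ∀ s, γ s ∉ S₂ := fun s h => by
    have : γ s ∈ (range γ)ᶜ := hS.union ▸ Or.inr h
    exact this ⟨s, rfl⟩
  have hcont : ContinuousOn (patch c n) (Icc (s₀ - δ) (s₀ + δ) ×ˢ Icc (-δ) δ) := fun q hq =>
    (hpc q (hdet q (hbox hq).1)).continuousWithinAt
  have hsubP : Icc (s₀ - δ) (s₀ + δ) ×ˢ Ioc 0 δ ⊆ Icc (s₀ - δ) (s₀ + δ) ×ˢ Icc (-δ) δ :=
    prod_mono_right fun t ht => ⟨by linarith [ht.1], ht.2⟩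
  have hsubM : Icc (s₀ - δ) (s₀ + δ) ×ˢ Ico (-δ) 0 ⊆ Icc (s₀ - δ) (s₀ + δ) ×ˢ Icc (-δ) δ :=
    prod_mono_right fun t ht => ⟨ht.1, by linarith [ht.2]⟩
  -- The upper half is connected and misses the curve, so it lies in one of the two parts; the
  -- orientation provides a point of it in `S₂`.
  have hplus : patch c n '' (Icc (s₀ - δ) (s₀ + δ) ×ˢ Ioc 0 δ) ⊆ S₂ := by
    have hconn : IsPreconnected (patch c n '' (Icc (s₀ - δ) (s₀ + δ) ×ˢ Ioc 0 δ)) :=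
      (isPreconnected_Icc.prod isPreconnected_Ioc).image _ (hcont.mono hsubP)
    refine hconn.subset_right_of_subset_union hS.isOpen₁ hS.isOpen₂ hS.disjoint ?_ ?_
    · rw [hS.union]
      rintro _ ⟨q, hq, rfl⟩ h
      exact hq.2.1.ne' (hcurve q (hsubP hq) h)
    · obtain ⟨ε, h1, h2⟩ := ((hor s₀).and (Ioc_mem_nhdsGT hδ)).exists
      exact ⟨_, ⟨(s₀, ε), ⟨by simp [hδ.le], h2⟩, rfl⟩, h1⟩
  -- If the lower half met `S₂`, connectedness would put it inside `S₂`. The neighbourhood `W` of `γ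
  -- s₀` would then contain no point of `S₁`, although `γ s₀` lies on the frontier of `S₁`.
  have hminus : ∀ q ∈ Icc (s₀ - δ) (s₀ + δ) ×ˢ Ico (-δ) 0, patch c n q ∉ S₂ := by
    intro q hq hqS
    have hconn : IsPreconnected (patch c n '' (Icc (s₀ - δ) (s₀ + δ) ×ˢ Ico (-δ) 0)) :=
      (isPreconnected_Icc.prod isPreconnected_Ico).image _ (hcont.mono hsubM)
    have hall : patch c n '' (Icc (s₀ - δ) (s₀ + δ) ×ˢ Ico (-δ) 0) ⊆ S₂ := by
      refine hconn.subset_right_of_subset_union hS.isOpen₁ hS.isOpen₂ hS.disjoint ?_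
        ⟨_, ⟨q, hq, rfl⟩, hqS⟩
      rw [hS.union]
      rintro _ ⟨q, hq, rfl⟩ h
      exact hq.2.2.ne (hcurve q (hsubM hq) h)
    have hcl : γ s₀ ∈ closure S₁ := by
      have : γ s₀ ∈ frontier S₁ := hS.frontier₁ ▸ ⟨s₀, rfl⟩
      exact this.1
    obtain ⟨x, ⟨r, hr, rfl⟩, hx⟩ := mem_closure_iff.1 hcl W hWo hpW
    rcases lt_trichotomy r.2 0 with h | h | h
    · exact disjoint_left.1 hS.disjoint hx (hall ⟨r, ⟨(hIoo hr).1, ⟨(hIoo hr).2.1, h⟩⟩, rfl⟩)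
    · have h1 : patch c n r = γ r.1 := by rw [← hp0, ← h]
      exact hnot1 _ (h1 ▸ hx)
    · exact disjoint_left.1 hS.disjoint hx (hplus ⟨r, ⟨(hIoo hr).1, ⟨h, (hIoo hr).2.2⟩⟩, rfl⟩)
  refine ⟨W, hWo, hpW, fun f hf hfW => ?_⟩
  have hzero : ∀ q ∈ Icc (s₀ - δ) (s₀ + δ) ×ˢ Icc (-δ) δ, q ∉ Q → f (patch c n q) = 0 := by
    intro q hq hq'
    apply image_eq_zero_of_notMem_tsupport
    intro h
    obtain ⟨q₁, hq₁, h1⟩ := hfW h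
    exact hq' (hinj (hbox hq).1 (hbox (hIoo hq₁)).1 h1.symm ▸ hq₁)
  have hab : s₀ - δ ≤ s₀ + δ := by linarith
  have key := setIntegral_surfDiv_patch hc (n := n) hab hδ
    (fun s hs => hdet (s, δ) (hbox ⟨hs, by simp [hδ.le]⟩).1)
    (fun q hq q' hq' h => hinj (hbox (hsubP hq)).1 (hbox (hsubP hq')).1 h) hS.isOpen₂
    (fun q hq => hplus ⟨q, hq, rfl⟩) hf
    (fun t ht => hzero _ (hsubP ⟨left_mem_Icc.2 hab, ht⟩) (by simp [hQ]))
    (fun t ht => hzero _ (hsubP ⟨right_mem_Icc.2 hab, ht⟩) (by simp [hQ]))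
    (fun s hs => hzero _ ⟨hs, by simp [hδ.le]⟩ (by simp [hQ]))
  rw [setIntegral_eq_of_subset_of_forall_sdiff_eq_zero hS.isOpen₂.measurableSet hplus, key]
  · set h : ℝ → ℝ := fun s => det3 (f (γ s)) (velocity γ s) (γ s) with hh
    have hper : Function.Periodic h L := fun s => by
      simp only [hh, hγ.periodic s, hγ.periodic_velocity s]
    have h1 : ∫ s in (0 : ℝ)..L, h s = ∫ s in (s₀ - L / 2)..(s₀ + L / 2), h s := by
      have := hper.intervalIntegral_add_eq 0 (s₀ - L / 2)
      rw [zero_add, show s₀ - L / 2 + L = s₀ + L / 2 by ring] at this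
      exact this
    rw [h1, intervalIntegral.integral_of_le (by linarith : s₀ - L / 2 ≤ s₀ + L / 2),
      setIntegral_eq_of_subset_of_forall_sdiff_eq_zero measurableSet_Ioc
        (s := Ioc (s₀ - δ) (s₀ + δ)) (Ioc_subset_Ioc (by linarith) (by linarith)),
      ← intervalIntegral.integral_of_le hab]
    · refine intervalIntegral.integral_congr fun s _ => ?_
      have h2 : ruled c n (s, 0) = γ s := by simp [ruled, hcdef]
      simp only [h2, norm_coe_sph, extField_coe, hh, hdc, inv_one, one_mul]
    · intro s hs
      have h2 : f (γ s) = 0 := by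
        apply image_eq_zero_of_notMem_tsupport
        intro hcon
        obtain ⟨q, hq, h3⟩ := hfW hcon
        have h4 := hcurve q (hIoo hq) (h3 ▸ ⟨s, rfl⟩)
        have h5 : γ s = γ q.1 := by rw [← hp0 q.1, ← h4, ← h3]
        have h6 := hγ.eq_of_eq h5 (by
          rw [abs_lt]
          constructor <;> linarith [hq.1.1, hq.1.2, hs.1.1, hs.1.2])
        exact hs.2 (h6 ▸ Ioo_subset_Ioc_self hq.1)
      simp [hh, h2, det3]
  · intro x hx
    apply surfDiv_eq_zero_of_notMem_tsupport
    intro hcon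
    obtain ⟨q, hq, rfl⟩ := hfW hcon
    rcases lt_trichotomy q.2 0 with h | h | h
    · exact hminus q ⟨(hIoo hq).1, ⟨(hIoo hq).2.1, h⟩⟩ hx.1
    · have h1 : patch c n q = γ q.1 := by rw [← hp0, ← h]
      exact hnot2 _ (h1 ▸ hx.1)
    · exact hx.2 ⟨q, ⟨(hIoo hq).1, ⟨h, (hIoo hq).2.2⟩⟩, rfl⟩

/-! ### The divergence theorem -/

instance : IsFiniteMeasure area := by
  unfold area
  infer_instance

lemma divE_smul {ψ : E3 → ℝ} {F : E3 → E3} {y : E3} (hψ : DifferentiableAt ℝ ψ y)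
    (hF : DifferentiableAt ℝ F y) :
    divE (fun y => ψ y • F y) y = ψ y * divE F y + fderiv ℝ ψ y (F y) := by
  have h1 : fderiv ℝ ψ y (F y) =
      ∑ j : Fin 3, F y j * fderiv ℝ ψ y (EuclideanSpace.single j 1) := by
    have hv : F y = ∑ j : Fin 3, F y j • (EuclideanSpace.single j 1 : E3) := by
      simpa using ((EuclideanSpace.basisFun (Fin 3) ℝ).sum_repr (F y)).symm
    conv_lhs => rw [hv]
    rw [map_sum]
    simp
  rw [h1, divE, divE, fderiv_fun_smul hψ hF]
  simp [Fin.sum_univ_three]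
  ring

lemma extField_fun_smul (φ : E3 → ℝ) (f : Sph → E3) :
    extField (fun x => φ x • f x) = fun y => φ (radial y) • extField f y := by
  ext1 y
  simp only [extField, smul_smul, mul_comm]

lemma contDiffAt_comp_radial {m : WithTop ℕ∞} {φ : E3 → ℝ} (hφ : ContDiff ℝ m φ) {y : E3}
    (hy : y ≠ 0) : ContDiffAt ℝ m (fun y => φ (radial y)) y :=
  hφ.contDiffAt.comp y (contDiffAt_coe_radial hy)

lemma IsDivField.differentiableAt {f : Sph → E3} {S : Set Sph} (hf : IsDivField f S)
    (hSo : IsOpen S) {x : Sph} (hx : x ∈ S) : DifferentiableAt ℝ (extField f) x :=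
  (hf.contDiffOn.differentiableOn one_ne_zero).differentiableAt
    ((isOpen_cone hSo).mem_nhds (coe_mem_cone.2 hx))

/-- `div (φ f) = φ div f + ∇φ · f`: the first term is a bounded multiple of an integrable function,
the second is continuous on the compact closure. -/
lemma IsDivField.smul {f : Sph → E3} {S : Set Sph} (hf : IsDivField f S) (hSo : IsOpen S)
    {φ : E3 → ℝ} (hφ : ContDiff ℝ 1 φ) : IsDivField (fun x => φ x • f x) S where
  continuousOn := (hφ.continuous.comp continuous_subtype_val).continuousOn.smul hf.continuousOn
  contDiffOn := by
    rw [extField_fun_smul]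
    exact ContDiffOn.smul (fun y hy => (contDiffAt_comp_radial hφ hy.1).contDiffWithinAt)
      hf.contDiffOn
  tangent x hx := by rw [real_inner_smul_left, hf.tangent x hx, mul_zero]
  integrable := by
    have hφd : ∀ x : Sph, ContDiffAt ℝ 1 (fun y => φ (radial y)) (x : E3) := fun x =>
      contDiffAt_comp_radial hφ (coe_sph_ne_zero x)
    have h1 : IntegrableOn (fun x : Sph => fderiv ℝ (fun y => φ (radial y)) (x : E3) (f x)) S
        area := by
      have hc : ContinuousOn
          (fun x : Sph => fderiv ℝ (fun y => φ (radial y)) (x : E3) (f x)) (closure S) := by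
        refine ContinuousOn.clm_apply (Continuous.continuousOn ?_) hf.continuousOn
        refine continuous_iff_continuousAt.2 fun x => ?_
        exact ContinuousAt.comp (f := ((↑) : Sph → E3))
          (g := fderiv ℝ (fun y => φ (radial y)))
          ((hφd x).continuousAt_fderiv one_ne_zero) continuous_subtype_val.continuousAt
      exact (hc.integrableOn_compact isClosed_closure.isCompact).mono_set subset_closure
    have h2 : IntegrableOn (fun x : Sph => φ x * surfDiv f x) S area := by
      have hc : Continuous fun x : Sph => φ x := hφ.continuous.comp continuous_subtype_val
      obtain ⟨C, hC⟩ := isCompact_univ.exists_bound_of_continuousOn hc.continuousOn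
      exact hf.integrable.bdd_mul (c := C) hc.aestronglyMeasurable
        (Eventually.of_forall fun x => hC x (mem_univ x))
    refine (integrableOn_congr_fun (fun x hx => ?_) hSo.measurableSet).1 (h2.add h1)
    rw [surfDiv, extField_fun_smul, divE_smul ((hφd x).differentiableAt one_ne_zero)
      (hf.differentiableAt hSo hx), radial_coe, extField_coe]
    rfl

lemma surfDiv_fun_sum {ι : Type*} [Fintype ι] {g : ι → Sph → E3} {x : Sph}
    (hg : ∀ i, DifferentiableAt ℝ (extField (g i)) x) :
    surfDiv (fun x => ∑ i, g i x) x = ∑ i, surfDiv (g i) x := by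
  have h1 : extField (fun x => ∑ i, g i x) = fun y => ∑ i, extField (g i) y := by
    ext1 y
    simp only [extField, Finset.smul_sum]
  rw [surfDiv, h1, divE, fderiv_fun_sum fun i _ => hg i]
  simp only [surfDiv, divE, _root_.sum_apply, WithLp.ofLp_sum,
    Finset.sum_apply]
  rw [Finset.sum_comm]

/-- Globalisation of the divergence theorem by a partition of unity. -/
lemma integral_surfDiv_of_local {S : Set Sph} (hSo : IsOpen S) {f : Sph → E3}
    (hf : IsDivField f S) (Λ : (Sph → E3) → ℝ)
    (hΛ : ∀ (ι : Type) [Fintype ι] (ρ : ι → E3 → ℝ), (∀ i, Continuous (ρ i)) →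
      Λ (fun x => ∑ i, ρ i x • f x) = ∑ i, Λ fun x => ρ i x • f x)
    (hloc : ∀ p, ∃ W, IsOpen W ∧ p ∈ W ∧ ∀ g : Sph → E3, IsDivField g S → tsupport g ⊆ W →
      ∫ x in S, surfDiv g x ∂area = Λ g) :
    ∫ x in S, surfDiv f x ∂area = Λ f := by
  choose W hWo hpW hW using hloc
  obtain ⟨t, ht⟩ := isCompact_univ.elim_finite_subcover W hWo fun p _ => mem_iUnion.2 ⟨p, hpW p⟩
  -- The partition of unity lives on Euclidean space, subordinate to the open cones over the cover,
  -- so that its members are smooth cutoffs in the sense of `IsDivField.smul`.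
  obtain ⟨ρ, hρ⟩ := SmoothPartitionOfUnity.exists_isSubordinate 𝓘(ℝ, E3)
    (s := Metric.sphere (0 : E3) 1) Metric.isClosed_sphere (fun i : t => cone (W i))
    (fun i => isOpen_cone (hWo i)) (by
      intro y hy
      obtain ⟨i, hi, h⟩ := mem_iUnion₂.1 (ht (mem_univ (⟨y, hy⟩ : Sph)))
      exact mem_iUnion.2 ⟨⟨i, hi⟩, coe_mem_cone.2 h⟩)
  have hρc : ∀ i, ContDiff ℝ 1 (ρ i) := fun i =>
    ((ρ i).contMDiff.contDiff).of_le (by exact_mod_cast le_top)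
  have hsum : ∀ x : Sph, ∑ i, ρ i (x : E3) = 1 := fun x => by
    rw [← finsum_eq_sum_of_fintype]
    exact ρ.sum_eq_one x.2
  have hfsum : f = fun x : Sph => ∑ i, ρ i (x : E3) • f x := by
    ext1 x
    rw [← Finset.sum_smul, hsum x, one_smul]
  have hfi : ∀ i, IsDivField (fun x : Sph => ρ i (x : E3) • f x) S := fun i => hf.smul hSo (hρc i)
  have hsupp : ∀ i, tsupport (fun x : Sph => ρ i (x : E3) • f x) ⊆ W i := by
    intro i
    have h1 : tsupport (fun x : Sph => ρ i (x : E3) • f x) ⊆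
        (Subtype.val : Sph → E3) ⁻¹' tsupport (ρ i) := by
      refine closure_minimal (fun x hx => subset_tsupport _ ?_)
        ((isClosed_tsupport _).preimage continuous_subtype_val)
      intro h
      simp [h] at hx
    exact fun x hx => coe_mem_cone.1 (hρ i (h1 hx))
  have hdiv : ∫ x in S, surfDiv f x ∂area =
      ∑ i, ∫ x in S, surfDiv (fun x : Sph => ρ i (x : E3) • f x) x ∂area := by
    rw [← integral_finsetSum _ fun i _ => (hfi i).integrable]
    refine setIntegral_congr_fun hSo.measurableSet fun x hx => ?_
    rw [← surfDiv_fun_sum fun i => (hfi i).differentiableAt hSo hx, ← hfsum]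
  rw [hdiv]
  conv_rhs => rw [hfsum]
  rw [hΛ _ (fun i => ρ i) fun i => (hρc i).continuous]
  exact Finset.sum_congr rfl fun i _ => hW i _ (hfi i) (hsupp i)

/-- The divergence theorem on the whole sphere. -/
theorem integral_surfDiv_eq_zero {f : Sph → E3} (hf : IsDivField f univ) :
    ∫ x, surfDiv f x ∂area = 0 := by
  have h := integral_surfDiv_of_local isOpen_univ hf (fun _ => 0) (by simp) fun p => by
    obtain ⟨W, -, h1, h2, h3⟩ := exists_nhds_integral_surfDiv_eq_zero isOpen_univ (mem_univ p)
    exact ⟨W, h1, h2, h3⟩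
  simpa using h

/-- The divergence theorem on a domain bounded by a regular closed curve. -/
theorem integral_surfDiv_eq_integral_det3 {γ : ℝ → Sph} {L : ℝ} {S₁ S₂ : Set Sph}
    (hγ : IsSimpleClosedCurve γ L) (hS : Divides γ S₁ S₂) (hor : PositivelyOriented γ S₂)
    {f : Sph → E3} (hf : IsDivField f S₂) :
    ∫ x in S₂, surfDiv f x ∂area = ∫ s in (0 : ℝ)..L, det3 (f (γ s)) (velocity γ s) (γ s) := by
  have hv : Continuous (velocity γ) := hγ.contDiff.continuous_deriv le_rfl
  have hγf : Continuous fun s => f (γ s) := by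
    refine hf.continuousOn.comp_continuous hγ.continuous fun s => ?_
    have : γ s ∈ frontier S₂ := hS.frontier₂ ▸ ⟨s, rfl⟩
    exact this.1
  have hnot : ∀ s, γ s ∉ S₁ ∪ S₂ := fun s h => by
    rw [hS.union] at h
    exact h ⟨s, rfl⟩
  have hvan : ∀ {W : Set Sph} {g : Sph → E3}, W ⊆ S₁ ∪ S₂ → tsupport g ⊆ W →
      ∫ s in (0 : ℝ)..L, det3 (g (γ s)) (velocity γ s) (γ s) = 0 := by
    intro W g hW hg
    have h0 : ∀ s, g (γ s) = 0 := fun s =>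
      image_eq_zero_of_notMem_tsupport fun h => hnot s (hW (hg h))
    simp [h0, det3]
  refine integral_surfDiv_of_local hS.isOpen₂ hf
    (fun g => ∫ s in (0 : ℝ)..L, det3 (g (γ s)) (velocity γ s) (γ s)) ?_ ?_
  · intro ι _ ρ hρ
    rw [← intervalIntegral.integral_finsetSum]
    · congr 1
      ext1 s
      simp only [← Finset.sum_smul, det3, PiLp.smul_apply, smul_eq_mul, mul_assoc,
        ← mul_add, ← Finset.sum_mul]
    · intro i _
      apply Continuous.intervalIntegrable
      rw [← continuousOn_univ]
      have h1 : Continuous fun s => ρ i (γ s) :=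
        (hρ i).comp (continuous_subtype_val.comp hγ.continuous)
      exact continuousOn_det3 (h1.smul hγf).continuousOn hv.continuousOn
        (continuous_subtype_val.comp hγ.continuous).continuousOn
  · intro p
    by_cases hp : p ∈ range γ
    · obtain ⟨s₀, rfl⟩ := hp
      exact exists_nhds_integral_surfDiv_eq_lineIntegral hγ hS hor s₀
    · have hp' : p ∈ S₁ ∪ S₂ := by rw [hS.union]; exact hp
      rcases hp' with hp1 | hp2
      -- A field supported in `S₁` vanishes on `S₂` and on the curve, so both sides are zero.
      · refine ⟨S₁, hS.isOpen₁, hp1, fun g _ hgs => ?_⟩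
        rw [hvan subset_union_left hgs]
        refine setIntegral_eq_zero_of_forall_eq_zero fun x hx => ?_
        exact surfDiv_eq_zero_of_notMem_tsupport fun h => disjoint_left.1 hS.disjoint (hgs h) hx
      · obtain ⟨W, hWS, h1, h2, h3⟩ := exists_nhds_integral_surfDiv_eq_zero hS.isOpen₂ hp2
        refine ⟨W, h1, h2, fun g hg hgs => ?_⟩
        rw [hvan (hWS.trans subset_union_right) hgs, h3 g hg hgs]

/-! ### Zonal fields -/

/-- The zonal field `h(t) (x₀ - t x)`, where `t = ⟨x, x₀⟩`. -/
def zonal (h : ℝ → ℝ) (x₀ x : Sph) : E3 :=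
  h ⟪(x : E3), (x₀ : E3)⟫ • ((x₀ : E3) - ⟪(x : E3), (x₀ : E3)⟫ • (x : E3))

lemma hasFDerivAt_norm_inv {y : E3} (hy : y ≠ 0) :
    HasFDerivAt (fun y : E3 => ‖y‖⁻¹) (-(‖y‖⁻¹ ^ 3) • innerSL ℝ y) y := by
  have hpos : 0 < ‖y‖ := norm_pos_iff.2 hy
  have h1 := (hasStrictFDerivAt_norm_sq y).hasFDerivAt.sqrt (by positivity)
  simp only [Real.sqrt_sq (norm_nonneg _)] at h1
  refine ((hasDerivAt_inv hpos.ne').comp_hasFDerivAt y h1).congr_fderiv ?_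
  ext v
  simp
  field_simp

lemma hasFDerivAt_norm_inv_coe (x : Sph) :
    HasFDerivAt (fun y : E3 => ‖y‖⁻¹) (-innerSL ℝ (x : E3)) x := by
  simpa using hasFDerivAt_norm_inv (coe_sph_ne_zero x)

lemma inner_sph_le_one (x x₀ : Sph) : ⟪(x : E3), (x₀ : E3)⟫ ≤ 1 := by
  simpa using real_inner_le_norm (x : E3) (x₀ : E3)

lemma neg_one_le_inner_sph (x x₀ : Sph) : -1 ≤ ⟪(x : E3), (x₀ : E3)⟫ := by
  have := abs_real_inner_le_norm (x : E3) (x₀ : E3)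
  simp only [norm_coe_sph, mul_one] at this
  exact (abs_le.1 this).1

lemma inner_self_sph (x : Sph) : ⟪(x : E3), (x : E3)⟫ = 1 := by
  rw [real_inner_self_eq_norm_sq, norm_coe_sph, one_pow]

lemma contDiffAt_height {m : WithTop ℕ∞} (x₀ : Sph) {y : E3} (hy : y ≠ 0) :
    ContDiffAt ℝ m (fun y => ⟪(radial y : E3), (x₀ : E3)⟫) y :=
  (contDiffAt_coe_radial hy).inner ℝ contDiffAt_const

lemma hasFDerivAt_height (x₀ x : Sph) :
    HasFDerivAt (fun y => ⟪(radial y : E3), (x₀ : E3)⟫)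
      (innerSL ℝ ((x₀ : E3) - ⟪(x : E3), (x₀ : E3)⟫ • (x : E3))) x := by
  have h1 : HasFDerivAt (fun y : E3 => ⟪y, (x₀ : E3)⟫) (innerSL ℝ (x₀ : E3)) x := by
    refine (innerSL ℝ (x₀ : E3)).hasFDerivAt.congr_of_eventuallyEq ?_
    exact Eventually.of_forall fun y => real_inner_comm _ _
  have h2 := (hasFDerivAt_norm_inv_coe x).mul h1
  refine (h2.congr_of_eventuallyEq ?_).congr_fderiv ?_
  · filter_upwards [isOpen_ne.mem_nhds (coe_sph_ne_zero x)] with y hy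
    rw [coe_radial hy, real_inner_smul_left]
    rfl
  · ext v
    simp
    ring

lemma divE_sub {F G : E3 → E3} {y : E3} (hF : DifferentiableAt ℝ F y)
    (hG : DifferentiableAt ℝ G y) :
    divE (fun y => F y - G y) y = divE F y - divE G y := by
  simp [divE, fderiv_fun_sub hF hG]

lemma divE_congr {F G : E3 → E3} {y : E3} (h : F =ᶠ[𝓝 y] G) : divE F y = divE G y := by
  simp only [divE, h.fderiv_eq]

lemma divE_const (v y : E3) : divE (fun _ => v) y = 0 := by simp [divE]

lemma divE_id (y : E3) : divE (fun y => y) y = 3 := by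
  simp [divE]

/-- The surface gradient of the height function `x ↦ ⟨x, x₀⟩`. -/
def heightGrad (x₀ x : Sph) : E3 := (x₀ : E3) - ⟪(x : E3), (x₀ : E3)⟫ • (x : E3)

lemma inner_heightGrad_self (x₀ x : Sph) : ⟪heightGrad x₀ x, (x : E3)⟫ = 0 := by
  rw [heightGrad, inner_sub_left, real_inner_smul_left, inner_self_sph, mul_one,
    real_inner_comm, sub_self]

lemma inner_heightGrad_heightGrad (x₀ x : Sph) :
    ⟪heightGrad x₀ x, heightGrad x₀ x⟫ = 1 - ⟪(x : E3), (x₀ : E3)⟫ ^ 2 := by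
  have h : ⟪(x₀ : E3), (x : E3)⟫ = ⟪(x : E3), (x₀ : E3)⟫ := real_inner_comm _ _
  simp only [heightGrad, inner_sub_left, inner_sub_right, real_inner_smul_left,
    real_inner_smul_right, inner_self_sph, h]
  ring

lemma contDiffAt_extField_heightGrad {m : WithTop ℕ∞} (x₀ : Sph) {y : E3} (hy : y ≠ 0) :
    ContDiffAt ℝ m (extField (heightGrad x₀)) y := by
  refine ((contDiffAt_norm ℝ hy).inv (norm_ne_zero_iff.2 hy)).smul ?_
  exact contDiffAt_const.sub ((contDiffAt_height x₀ hy).smul (contDiffAt_coe_radial hy))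

/-- The height `t` is a spherical harmonic of degree 1, with eigenvalue -2. The computation is the
product rule for `|y|⁻¹ x₀ - (t |y|⁻²) y`. -/
lemma surfDiv_heightGrad (x₀ x : Sph) :
    surfDiv (heightGrad x₀) x = -2 * ⟪(x : E3), (x₀ : E3)⟫ := by
  have hN := hasFDerivAt_norm_inv_coe x
  have hT := hasFDerivAt_height x₀ x
  have hTN := (hT.fun_mul hN).fun_mul hN
  have h1 : extField (heightGrad x₀) =ᶠ[𝓝 (x : E3)] fun y =>
      ‖y‖⁻¹ • (x₀ : E3) - (⟪(radial y : E3), (x₀ : E3)⟫ * ‖y‖⁻¹ * ‖y‖⁻¹) • y := by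
    filter_upwards [isOpen_ne.mem_nhds (coe_sph_ne_zero x)] with y hy
    simp only [extField, heightGrad, smul_sub, smul_smul]
    congr 1
    conv_lhs => rw [show (radial y : E3) = ‖y‖⁻¹ • y from coe_radial hy]
    rw [smul_smul, coe_radial hy]
    congr 1
    ring
  rw [surfDiv, divE_congr h1, divE_sub
    (hN.differentiableAt.smul_const (x₀ : E3)) (hTN.differentiableAt.fun_smul differentiableAt_fun_id),
    divE_smul hN.differentiableAt (differentiableAt_const _),
    divE_smul (F := fun y => y) (ψ := fun y => ⟪(radial y : E3), (x₀ : E3)⟫ * ‖y‖⁻¹ * ‖y‖⁻¹)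
      hTN.differentiableAt differentiableAt_fun_id, divE_const, divE_id, hN.fderiv, hTN.fderiv]
  have h2 := inner_heightGrad_self x₀ x
  rw [heightGrad] at h2
  simp only [radial_coe, norm_coe_sph, _root_.neg_apply,
    _root_.add_apply, _root_.smul_apply, innerSL_apply_apply, h2,
    inner_self_sph, smul_eq_mul]
  ring

lemma extField_zonal (h : ℝ → ℝ) (x₀ : Sph) :
    extField (zonal h x₀) =
      fun y => h ⟪(radial y : E3), (x₀ : E3)⟫ • extField (heightGrad x₀) y := by
  ext1 y
  simp only [extField, zonal, heightGrad]
  rw [smul_comm]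

/-- The product rule for `h(t) ∇t`, with `|∇t|² = 1 - t²` and `Δt = -2t`; the result is `((1 - t²)
h)'`. -/
lemma surfDiv_zonal {h : ℝ → ℝ} {h' : ℝ} {x₀ x : Sph}
    (hh : HasDerivAt h h' ⟪(x : E3), (x₀ : E3)⟫) :
    surfDiv (zonal h x₀) x =
      (1 - ⟪(x : E3), (x₀ : E3)⟫ ^ 2) * h' -
        2 * ⟪(x : E3), (x₀ : E3)⟫ * h ⟪(x : E3), (x₀ : E3)⟫ := by
  have h1 : HasFDerivAt (fun y => h ⟪(radial y : E3), (x₀ : E3)⟫)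
      (h' • innerSL ℝ (heightGrad x₀ x)) x := by
    have hh' : HasDerivAt h h' ⟪(radial (x : E3) : E3), (x₀ : E3)⟫ := by rwa [radial_coe]
    exact hh'.comp_hasFDerivAt (x : E3) (hasFDerivAt_height x₀ x)
  have hd : DifferentiableAt ℝ (extField (heightGrad x₀)) x :=
    (contDiffAt_extField_heightGrad (m := 1) x₀ (coe_sph_ne_zero x)).differentiableAt one_ne_zero
  rw [surfDiv, extField_zonal, divE_smul h1.differentiableAt hd, h1.fderiv, extField_coe]
  change _ * surfDiv (heightGrad x₀) x + _ = _
  rw [surfDiv_heightGrad, _root_.smul_apply, innerSL_apply_apply,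
    inner_heightGrad_heightGrad, radial_coe]
  simp only [smul_eq_mul]
  ring

lemma contDiffAt_extField_zonal {m : WithTop ℕ∞} {h : ℝ → ℝ} {x₀ : Sph} {y : E3} (hy : y ≠ 0)
    (hh : ContDiffAt ℝ m h ⟪(radial y : E3), (x₀ : E3)⟫) :
    ContDiffAt ℝ m (extField (zonal h x₀)) y := by
  rw [extField_zonal]
  exact ContDiffAt.smul (hh.comp y (contDiffAt_height x₀ hy)) (contDiffAt_extField_heightGrad x₀ hy)

lemma continuous_height (x₀ : Sph) : Continuous fun x : Sph => ⟪(x : E3), (x₀ : E3)⟫ := by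
  fun_prop

lemma continuous_heightGrad (x₀ : Sph) : Continuous (heightGrad x₀) := by
  unfold heightGrad
  fun_prop

lemma continuous_comp_height {h : ℝ → ℝ} (hh : ContinuousOn h (Iic 1)) (x₀ : Sph) :
    Continuous fun x : Sph => h ⟪(x : E3), (x₀ : E3)⟫ :=
  hh.comp_continuous (continuous_height x₀) fun x => inner_sph_le_one x x₀

lemma continuous_zonal {h : ℝ → ℝ} (hh : ContinuousOn h (Iic 1)) (x₀ : Sph) :
    Continuous (zonal h x₀) :=
  (continuous_comp_height hh x₀).smul (continuous_heightGrad x₀)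

/-- The integral of the divergence of a zonal field vanishes. -/
lemma integral_zonal {h h' : ℝ → ℝ} (hh : ∀ t ≤ 1, HasDerivAt h (h' t) t)
    (hc : ∀ t ≤ 1, ContDiffAt ℝ 1 h t) (hh' : ContinuousOn h' (Iic 1)) (x₀ : Sph) :
    ∫ x : Sph, ((1 - ⟪(x : E3), (x₀ : E3)⟫ ^ 2) * h' ⟪(x : E3), (x₀ : E3)⟫ -
        2 * ⟪(x : E3), (x₀ : E3)⟫ * h ⟪(x : E3), (x₀ : E3)⟫) ∂area = 0 := by
  have hhc : ContinuousOn h (Iic 1) := fun t ht => (hh t ht).continuousAt.continuousWithinAt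
  have e : surfDiv (zonal h x₀) = fun x : Sph =>
      (1 - ⟪(x : E3), (x₀ : E3)⟫ ^ 2) * h' ⟪(x : E3), (x₀ : E3)⟫ -
        2 * ⟪(x : E3), (x₀ : E3)⟫ * h ⟪(x : E3), (x₀ : E3)⟫ := by
    ext1 x
    exact surfDiv_zonal (hh _ (inner_sph_le_one x x₀))
  rw [← e]
  refine integral_surfDiv_eq_zero ⟨(continuous_zonal hhc x₀).continuousOn, ?_, ?_, ?_⟩
  · exact fun y hy => (contDiffAt_extField_zonal hy.1
      (hc _ (inner_sph_le_one (radial y) x₀))).contDiffWithinAt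
  · intro x _
    rw [zonal, real_inner_smul_left]
    exact mul_eq_zero_of_right _ (inner_heightGrad_self x₀ x)
  · rw [e]
    have h1 := continuous_comp_height hhc x₀
    have h2 := continuous_comp_height hh' x₀
    have h3 := continuous_height x₀
    refine (Continuous.continuousOn ?_).integrableOn_compact isCompact_univ
    exact ((continuous_const.sub (h3.pow 2)).mul h2).sub ((continuous_const.mul h3).mul h1)

/-! ### Green's identity with a regularised fundamental solution -/

lemma inner_gradient (U : E3 → ℝ) (y v : E3) : ⟪gradient U y, v⟫ = fderiv ℝ U y v := by
  rw [gradient, InnerProductSpace.toDual_symm_apply]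

lemma gradient_coord (U : E3 → ℝ) (y : E3) (i : Fin 3) :
    gradient U y i = fderiv ℝ U y (EuclideanSpace.single i 1) := by
  rw [← inner_gradient, EuclideanSpace.inner_single_right]
  simp

lemma contDiffOn_gradient {U : E3 → ℝ} {O : Set E3} (hO : IsOpen O) (hU : ContDiffOn ℝ 2 U O) :
    ContDiffOn ℝ 1 (gradient U) O := by
  rw [contDiffOn_euclidean]
  intro i
  simp only [gradient_coord]
  exact (hU.fderiv_of_isOpen hO (by norm_num)).clm_apply contDiffOn_const

lemma divE_gradient {U : E3 → ℝ} {y : E3} (hU : ContDiffAt ℝ 2 U y) :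
    divE (gradient U) y = Laplacian.laplacian U y := by
  have h1 : DifferentiableAt ℝ (fderiv ℝ U) y :=
    (hU.fderiv_right (m := 1) (by norm_num)).differentiableAt one_ne_zero
  have hcoord : ∀ i, DifferentiableAt ℝ (fun y => gradient U y i) y := fun i => by
    simp only [gradient_coord]
    exact h1.clm_apply (differentiableAt_const _)
  have h2 : DifferentiableAt ℝ (gradient U) y := differentiableAt_euclidean.2 hcoord
  rw [congrFun (InnerProductSpace.laplacian_eq_iteratedFDeriv_orthonormalBasis U
    (EuclideanSpace.basisFun (Fin 3) ℝ)) y, divE]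
  refine Finset.sum_congr rfl fun i _ => ?_
  rw [iteratedFDeriv_two_apply]
  have h3 : HasFDerivAt (fun y => gradient U y i)
      ((EuclideanSpace.proj i : E3 →L[ℝ] ℝ).comp (fderiv ℝ (gradient U) y)) y :=
    (EuclideanSpace.proj i : E3 →L[ℝ] ℝ).hasFDerivAt.comp y h2.hasFDerivAt
  have h4 : HasFDerivAt (fun y => gradient U y i)
      ((fderiv ℝ (fderiv ℝ U) y).flip (EuclideanSpace.single i 1)) y := by
    simp only [gradient_coord]
    have := h1.hasFDerivAt.clm_apply (hasFDerivAt_const (EuclideanSpace.single i (1 : ℝ)) y)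
    refine this.congr_fderiv ?_
    ext v
    simp
  have h5 := congrArg (fun A : E3 →L[ℝ] ℝ => A (EuclideanSpace.single i 1)) (h3.unique h4)
  simpa using h5

/-- A function of degree 0 has a gradient of degree -1; this dictates the weight in `extField` and
makes `surfDiv` of the surface gradient the Laplace-Beltrami operator. -/
lemma extField_surfGrad (u : Sph → ℝ) {y : E3} (hy : y ≠ 0) :
    extField (surfGrad u) y = gradient (homExt u) y := by
  have hr : 0 < ‖y‖⁻¹ := inv_pos.2 (norm_pos_iff.2 hy)
  have h1 := fderiv_comp_smul (𝕜 := ℝ) (f := homExt u) (x := y) ‖y‖⁻¹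
  have h2 : (fun z => homExt u (‖y‖⁻¹ • z)) =ᶠ[𝓝 y] homExt u := by
    filter_upwards [isOpen_ne.mem_nhds hy] with z hz
    rw [homExt, homExt, radial_smul hr hz]
  rw [h2.fderiv_eq, ← coe_radial hy] at h1
  ext i
  simp only [extField, surfGrad, PiLp.smul_apply, gradient_coord, h1]
  simp

lemma inner_surfGrad_self {u : Sph → ℝ} {x : Sph} (hu : DifferentiableAt ℝ (homExt u) x) :
    ⟪surfGrad u x, (x : E3)⟫ = 0 := by
  rw [surfGrad, inner_gradient]
  have h1 : HasDerivAt (fun r : ℝ => homExt u (r • (x : E3))) (fderiv ℝ (homExt u) x x) 1 := by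
    have hd : HasDerivAt (fun r : ℝ => r • (x : E3)) x 1 := by
      simpa using (hasDerivAt_id (1 : ℝ)).smul_const (x : E3)
    have hf' : HasFDerivAt (homExt u) (fderiv ℝ (homExt u) x) ((1 : ℝ) • (x : E3)) := by
      simpa using hu.hasFDerivAt
    exact hf'.comp_hasDerivAt 1 hd
  have h3 : (fun r : ℝ => homExt u (r • (x : E3))) =ᶠ[𝓝 1] fun _ => u x := by
    filter_upwards [lt_mem_nhds (zero_lt_one' ℝ)] with r hr
    rw [homExt, radial_smul hr (coe_sph_ne_zero x), radial_coe]
  exact h1.unique ((hasDerivAt_const 1 (u x)).congr_of_eventuallyEq h3)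

/-- The regularised fundamental solution. -/
def regSol (ε : ℝ) (x₀ x : Sph) : ℝ :=
  -(1 / (4 * Real.pi)) * Real.log (1 + ε - ⟪(x : E3), (x₀ : E3)⟫)

/-- The derivative of the profile of the regularised fundamental solution. -/
def regSlope (ε t : ℝ) : ℝ := 1 / (4 * Real.pi) * (1 + ε - t)⁻¹

/-- The approximate identity given by the regularised fundamental solution. -/
def regKernel (ε : ℝ) (x₀ x : Sph) : ℝ :=
  1 / (4 * Real.pi) * (2 * ε + ε ^ 2) * ((1 + ε - ⟪(x : E3), (x₀ : E3)⟫)⁻¹) ^ 2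

lemma fundSol_eq_regSol (x₀ : Sph) : (fun x => fundSol x x₀) = regSol 0 x₀ := by
  ext1 x
  simp [fundSol, regSol]

lemma hasDerivAt_regSlope {ε t : ℝ} (h : 1 + ε - t ≠ 0) :
    HasDerivAt (regSlope ε) (1 / (4 * Real.pi) * ((1 + ε - t)⁻¹) ^ 2) t := by
  have h1 : HasDerivAt (fun t => 1 + ε - t) (-1) t := by
    simpa using (hasDerivAt_id t).const_sub (1 + ε)
  refine ((h1.inv h).const_mul (1 / (4 * Real.pi))).congr_deriv ?_
  field_simp

lemma contDiffAt_regSlope {m : WithTop ℕ∞} {ε t : ℝ} (h : 1 + ε - t ≠ 0) :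
    ContDiffAt ℝ m (regSlope ε) t :=
  contDiffAt_const.mul ((contDiffAt_const.sub contDiffAt_id).inv h)

/-- This rests on `1 - t² - 2t (1 + ε - t) = (1 + ε - t)² - (2ε + ε²)`. -/
lemma surfDiv_regGrad {ε : ℝ} {x₀ x : Sph} (h : 1 + ε - ⟪(x : E3), (x₀ : E3)⟫ ≠ 0) :
    surfDiv (zonal (regSlope ε) x₀) x = 1 / (4 * Real.pi) - regKernel ε x₀ x := by
  rw [surfDiv_zonal (hasDerivAt_regSlope h), regSlope, regKernel]
  field_simp
  ring

lemma hasFDerivAt_homExt_regSol {ε : ℝ} {x₀ x : Sph} (h : 1 + ε - ⟪(x : E3), (x₀ : E3)⟫ ≠ 0) :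
    HasFDerivAt (homExt (regSol ε x₀)) (innerSL ℝ (zonal (regSlope ε) x₀ x)) x := by
  have h1 := hasFDerivAt_height x₀ x
  have h' : 1 + ε - ⟪(radial (x : E3) : E3), (x₀ : E3)⟫ ≠ 0 := by rwa [radial_coe]
  have h2 := ((h1.const_sub (1 + ε)).log h').const_mul (-(1 / (4 * Real.pi)))
  refine h2.congr_fderiv ?_
  ext v
  simp only [zonal, regSlope, radial_coe, _root_.smul_apply, _root_.neg_apply,
    innerSL_apply_apply, real_inner_smul_left, smul_eq_mul]
  ring

lemma surfGrad_regSol {ε : ℝ} {x₀ x : Sph} (h : 1 + ε - ⟪(x : E3), (x₀ : E3)⟫ ≠ 0) :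
    surfGrad (regSol ε x₀) x = zonal (regSlope ε) x₀ x := by
  ext i
  rw [surfGrad, gradient_coord, (hasFDerivAt_homExt_regSol h).fderiv, innerSL_apply_apply,
    EuclideanSpace.inner_single_right]
  simp

lemma contDiffAt_homExt_regSol {m : WithTop ℕ∞} {ε : ℝ} (hε : 0 < ε) (x₀ : Sph) {y : E3}
    (hy : y ≠ 0) : ContDiffAt ℝ m (homExt (regSol ε x₀)) y := by
  have h := inner_sph_le_one (radial y) x₀
  have h' : 1 + ε - ⟪(radial y : E3), (x₀ : E3)⟫ ≠ 0 := by linarith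
  exact contDiffAt_const.mul ((contDiffAt_const.sub (contDiffAt_height x₀ hy)).log h')

lemma continuous_regSol {ε : ℝ} (hε : 0 < ε) (x₀ : Sph) : Continuous (regSol ε x₀) := by
  refine continuous_const.mul ((continuous_const.sub (continuous_height x₀)).log fun x => ?_)
  have h : 1 + ε - ⟪(x : E3), (x₀ : E3)⟫ ≠ 0 := by linarith [inner_sph_le_one x x₀]
  exact h

lemma continuousOn_regSlope {ε : ℝ} (hε : 0 < ε) : ContinuousOn (regSlope ε) (Iic 1) := by
  intro t ht
  have ht' : t ≤ 1 := ht
  exact (hasDerivAt_regSlope (ε := ε) (t := t) (by linarith)).continuousAt.continuousWithinAt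

lemma continuous_regKernel {ε : ℝ} (hε : 0 < ε) (x₀ : Sph) : Continuous (regKernel ε x₀) := by
  refine continuous_const.mul
    (((continuous_const.sub (continuous_height x₀)).inv₀ fun x => ?_).pow 2)
  have h : 1 + ε - ⟪(x : E3), (x₀ : E3)⟫ ≠ 0 := by linarith [inner_sph_le_one x x₀]
  exact h

/-- The field whose divergence theorem is Green's second identity. -/
def greenField (ε : ℝ) (x₀ : Sph) (u : Sph → ℝ) (G : Sph → E3) (x : Sph) : E3 :=
  u x • zonal (regSlope ε) x₀ x - regSol ε x₀ x • G x

section Green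

variable {ε : ℝ} {x₀ : Sph} {u : Sph → ℝ} {G : Sph → E3} {S : Set Sph}

lemma extField_greenField (hG : EqOn G (surfGrad u) S) {y : E3} (hy : y ∈ cone S) :
    extField (greenField ε x₀ u G) y =
      homExt u y • extField (zonal (regSlope ε) x₀) y -
        homExt (regSol ε x₀) y • gradient (homExt u) y := by
  rw [← extField_surfGrad u hy.1]
  simp only [extField, greenField, hG hy.2, homExt, smul_sub, smul_smul]
  rw [mul_comm, mul_comm ‖y‖⁻¹]

/-- The mixed terms `∇u · ∇U_ε` cancel. -/
lemma surfDiv_greenField (hε : 0 < ε) (hSo : IsOpen S)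
    (hu : ContDiffOn ℝ 2 (homExt u) (cone S)) (hG : EqOn G (surfGrad u) S) {x : Sph}
    (hx : x ∈ S) :
    surfDiv (greenField ε x₀ u G) x =
      u x * (1 / (4 * Real.pi) - regKernel ε x₀ x) - regSol ε x₀ x * laplaceBeltrami u x := by
  have hne : 1 + ε - ⟪(x : E3), (x₀ : E3)⟫ ≠ 0 := by linarith [inner_sph_le_one x x₀]
  have hmem : (x : E3) ∈ cone S := coe_mem_cone.2 hx
  have hnhds := (isOpen_cone hSo).mem_nhds hmem
  have h1 : extField (greenField ε x₀ u G) =ᶠ[𝓝 (x : E3)] fun y =>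
      homExt u y • extField (zonal (regSlope ε) x₀) y -
        homExt (regSol ε x₀) y • gradient (homExt u) y := by
    filter_upwards [hnhds] with y hy using extField_greenField hG hy
  have hu' : ContDiffAt ℝ 2 (homExt u) x := hu.contDiffAt hnhds
  have d1 : DifferentiableAt ℝ (homExt u) x := hu'.differentiableAt two_ne_zero
  have d2 : DifferentiableAt ℝ (extField (zonal (regSlope ε) x₀)) x :=
    (contDiffAt_extField_zonal (m := 1) (coe_sph_ne_zero x) (contDiffAt_regSlope
      (by rwa [radial_coe]))).differentiableAt one_ne_zero
  have h3 := hasFDerivAt_homExt_regSol hne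
  have d4 : DifferentiableAt ℝ (gradient (homExt u)) x :=
    ((contDiffOn_gradient (isOpen_cone hSo) hu).contDiffAt hnhds).differentiableAt one_ne_zero
  rw [surfDiv, divE_congr h1, divE_sub (d1.fun_smul d2) (h3.differentiableAt.fun_smul d4),
    divE_smul d1 d2, divE_smul h3.differentiableAt d4, divE_gradient hu', h3.fderiv,
    ← inner_gradient, extField_coe, innerSL_apply_apply, homExt, homExt, radial_coe]
  change u x * surfDiv (zonal (regSlope ε) x₀) x + _ - (_ * laplaceBeltrami u x + _) = _
  rw [surfDiv_regGrad hne, real_inner_comm]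
  ring

lemma isDivField_greenField (hε : 0 < ε) (hSo : IsOpen S)
    (hu : ContDiffOn ℝ 2 (homExt u) (cone S)) (huc : ContinuousOn u (closure S))
    (hGc : ContinuousOn G (closure S)) (hG : EqOn G (surfGrad u) S)
    (hΔ : IntegrableOn (laplaceBeltrami u) S area) :
    IsDivField (greenField ε x₀ u G) S where
  continuousOn := (huc.smul (continuous_zonal (continuousOn_regSlope hε) x₀).continuousOn).sub
    ((continuous_regSol hε x₀).continuousOn.smul hGc)
  contDiffOn := by
    have h1 : ContDiffOn ℝ 1 (extField (zonal (regSlope ε) x₀)) (cone S) := fun y hy => by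
      refine (contDiffAt_extField_zonal hy.1 (contDiffAt_regSlope ?_)).contDiffWithinAt
      linarith [inner_sph_le_one (radial y) x₀]
    have h2 : ContDiffOn ℝ 1 (homExt (regSol ε x₀)) (cone S) := fun y hy =>
      (contDiffAt_homExt_regSol hε x₀ hy.1).contDiffWithinAt
    have h3 := ((hu.of_le one_le_two).smul h1).sub
      (h2.smul (contDiffOn_gradient (isOpen_cone hSo) hu))
    exact h3.congr fun y hy => extField_greenField hG hy
  tangent x hx := by
    have hd : DifferentiableAt ℝ (homExt u) x :=
      (hu.contDiffAt ((isOpen_cone hSo).mem_nhds (coe_mem_cone.2 hx))).differentiableAt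
        two_ne_zero
    have h1 : ⟪zonal (regSlope ε) x₀ x, (x : E3)⟫ = 0 := by
      rw [zonal, real_inner_smul_left]
      exact mul_eq_zero_of_right _ (inner_heightGrad_self x₀ x)
    rw [greenField, inner_sub_left, real_inner_smul_left, real_inner_smul_left, h1, hG hx,
      inner_surfGrad_self hd]
    ring
  integrable := by
    have h1 : IntegrableOn (fun x => u x * (1 / (4 * Real.pi) - regKernel ε x₀ x)) S area :=
      ((huc.mul (continuous_const.sub (continuous_regKernel hε x₀)).continuousOn).integrableOn_compact
        isClosed_closure.isCompact).mono_set subset_closure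
    have h2 : IntegrableOn (fun x => regSol ε x₀ x * laplaceBeltrami u x) S area := by
      have hc := continuous_regSol hε x₀
      obtain ⟨C, hC⟩ := isCompact_univ.exists_bound_of_continuousOn hc.continuousOn
      exact hΔ.bdd_mul (c := C) hc.aestronglyMeasurable
        (Eventually.of_forall fun x => hC x (mem_univ x))
    refine (integrableOn_congr_fun (fun x hx => ?_) hSo.measurableSet).1 (h1.sub h2)
    exact (surfDiv_greenField hε hSo hu hG hx).symm

end Green

/-! ### Integrability of the fundamental solution -/

lemma area_real_univ : area.real univ = 4 * Real.pi := by
  have h : (volume : Measure E3).real (Metric.ball 0 1) = Real.pi * 4 / 3 := by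
    rw [measureReal_def, EuclideanSpace.volume_ball_fin_three]
    simp
    positivity
  rw [area, Measure.toSphere_real_apply_univ, h]
  simp
  ring

/-- The cone over a point lies in a line, which is a null set in space. -/
lemma area_singleton (x₀ : Sph) : area {x₀} = 0 := by
  have hne : (ℝ ∙ (x₀ : E3)) ≠ ⊤ := by
    intro h
    obtain ⟨e, he1, he2⟩ := exists_orthogonal_unit x₀
    have he : e ∈ (ℝ ∙ (x₀ : E3)) := h ▸ Submodule.mem_top
    obtain ⟨r, rfl⟩ := Submodule.mem_span_singleton.1 he
    rw [real_inner_smul_right, inner_self_sph, mul_one] at he2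
    simp [he2] at he1
  rw [area, Measure.toSphere_apply' _ (measurableSet_singleton x₀)]
  refine mul_eq_zero_of_right _ (measure_mono_null ?_ (Measure.addHaar_submodule volume _ hne))
  rintro _ ⟨r, -, _, ⟨x, rfl, rfl⟩, rfl⟩
  exact Submodule.smul_mem _ _ (Submodule.mem_span_singleton_self _)

lemma inner_sph_lt_one {x x₀ : Sph} (h : x ≠ x₀) : ⟪(x : E3), (x₀ : E3)⟫ < 1 := by
  refine lt_of_le_of_ne (inner_sph_le_one x x₀) fun h1 => h (Subtype.ext ?_)
  exact (inner_eq_one_iff_of_norm_eq_one (norm_coe_sph x) (norm_coe_sph x₀)).1 h1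

lemma ae_ne_sph (x₀ : Sph) : ∀ᵐ x ∂area, x ≠ x₀ := by
  rw [ae_iff]
  simpa using area_singleton x₀

/-- The divergence `1/4π - K_ε` has integral zero over a sphere of area `4π`. -/
lemma integral_regKernel {ε : ℝ} (hε : 0 < ε) (x₀ : Sph) : ∫ x, regKernel ε x₀ x ∂area = 1 := by
  have hne : ∀ t : ℝ, t ≤ 1 → 1 + ε - t ≠ 0 := fun t ht => by linarith
  have h := integral_zonal (h := regSlope ε)
    (h' := fun t => 1 / (4 * Real.pi) * ((1 + ε - t)⁻¹) ^ 2)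
    (fun t ht => hasDerivAt_regSlope (hne t ht)) (fun t ht => contDiffAt_regSlope (hne t ht))
    (continuousOn_const.mul (((continuousOn_const.sub continuousOn_id).inv₀
      fun t ht => hne t ht).pow 2)) x₀
  have e : ∀ x : Sph, (1 - ⟪(x : E3), (x₀ : E3)⟫ ^ 2) *
      (1 / (4 * Real.pi) * ((1 + ε - ⟪(x : E3), (x₀ : E3)⟫)⁻¹) ^ 2) -
      2 * ⟪(x : E3), (x₀ : E3)⟫ * regSlope ε ⟪(x : E3), (x₀ : E3)⟫ =
      1 / (4 * Real.pi) - regKernel ε x₀ x := fun x => by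
    have h1 := hne _ (inner_sph_le_one x x₀)
    rw [← surfDiv_regGrad h1, surfDiv_zonal (hasDerivAt_regSlope h1)]
  simp only [e] at h
  have hi : Integrable (regKernel ε x₀) area := by
    rw [← integrableOn_univ]
    exact (continuous_regKernel hε x₀).continuousOn.integrableOn_compact isCompact_univ
  rw [integral_sub (integrable_const _) hi, integral_const, area_real_univ] at h
  have := Real.pi_pos
  simp only [smul_eq_mul] at h
  field_simp at h
  linarith

/-- The zonal field with profile `log(1 + ε - t)` has a divergence of integral zero, so the integral
of `-2t log(1 + ε - t)` equals that of `(1 - t²) / (1 + ε - t)`, which is bounded uniformly in `ε`.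
Fatou's lemma carries the bound to `ε = 0`, and near `t = 1` the factor `-2t` is harmless. -/
lemma integrable_log_one_sub_inner (x₀ : Sph) :
    Integrable (fun x : Sph => Real.log (1 - ⟪(x : E3), (x₀ : E3)⟫)) area := by
  set T : Sph → ℝ := fun x => ⟪(x : E3), (x₀ : E3)⟫ with hT
  have hTc : Continuous T := continuous_height x₀
  have hT1 : ∀ x, T x ≤ 1 := fun x => inner_sph_le_one x x₀
  have hT2 : ∀ x, -1 ≤ T x := fun x => neg_one_le_inner_sph x x₀
  have hl2 : 0 < Real.log 2 := Real.log_pos one_lt_two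
  -- The constant `2 log 2` makes `g` nonnegative for `ε ≤ 1`: where `t ≥ 0` the logarithm is at
  -- most `log 2`, and where `t ≤ 0` it is nonnegative.
  set g : ℝ → Sph → ℝ := fun ε x => -2 * T x * Real.log (1 + ε - T x) + 2 * Real.log 2 with hg
  set e : ℕ → ℝ := fun k => 1 / ((k : ℝ) + 1) with he
  have he0 : ∀ k, 0 < e k := fun k => by positivity
  have he1 : ∀ k, e k ≤ 1 := fun k => by
    rw [he]
    simp only
    rw [div_le_one (by positivity)]
    linarith [Nat.cast_nonneg (α := ℝ) k]
  have hlim : Tendsto e atTop (𝓝 0) := tendsto_one_div_add_atTop_nhds_zero_nat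
  have hgc : ∀ k, Continuous (g (e k)) := fun k => by
    refine ((continuous_const.mul hTc).mul ((continuous_const.sub hTc).log fun x => ?_)).add
      continuous_const
    have : 1 + e k - T x ≠ 0 := by linarith [hT1 x, he0 k]
    exact this
  have hnonneg : ∀ ε, 0 ≤ ε → ε ≤ 1 → ∀ x, 0 < 1 + ε - T x → 0 ≤ g ε x := by
    intro ε h0 h1 x hx
    rcases le_total 0 (T x) with h | h
    · have h2 : Real.log (1 + ε - T x) ≤ Real.log 2 := Real.log_le_log hx (by linarith)
      have h3 : T x * Real.log (1 + ε - T x) ≤ 1 * Real.log 2 :=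
        (mul_le_mul_of_nonneg_left h2 h).trans (mul_le_mul_of_nonneg_right (hT1 x) hl2.le)
      simp only [hg]
      linarith
    · have h2 : 0 ≤ Real.log (1 + ε - T x) := Real.log_nonneg (by linarith)
      have h3 : T x * Real.log (1 + ε - T x) ≤ 0 := mul_nonpos_of_nonpos_of_nonneg h h2
      simp only [hg]
      linarith
  have hint : ∀ {F : Sph → ℝ}, Continuous F → Integrable F area := fun {F} hF => by
    rw [← integrableOn_univ]
    exact hF.continuousOn.integrableOn_compact isCompact_univ
  have hbound : ∀ k, ∫ x, g (e k) x ∂area ≤ ∫ _x : Sph, (2 + 2 * Real.log 2) ∂area := by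
    intro k
    have hne : ∀ t : ℝ, t ≤ 1 → 1 + e k - t ≠ 0 := fun t ht => by linarith [he0 k]
    have h := integral_zonal (h := fun t => Real.log (1 + e k - t))
      (h' := fun t => -(1 + e k - t)⁻¹)
      (fun t ht => by
        have h1 : HasDerivAt (fun t => 1 + e k - t) (-1) t := by
          simpa using (hasDerivAt_id t).const_sub (1 + e k)
        refine (h1.log (hne t ht)).congr_deriv ?_
        rw [neg_div, one_div])
      (fun t ht => (contDiffAt_const.sub contDiffAt_id).log (hne t ht))
      (((continuousOn_const.sub continuousOn_id).inv₀ fun t ht => hne t ht).neg) x₀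
    have hc : Continuous fun x => (1 - T x ^ 2) * (1 + e k - T x)⁻¹ :=
      (continuous_const.sub (hTc.pow 2)).mul
        ((continuous_const.sub hTc).inv₀ fun x => hne _ (hT1 x))
    have hc' : Integrable (fun x => (1 - T x ^ 2) * (1 + e k - T x)⁻¹ + 2 * Real.log 2) area :=
      (hint hc).add (integrable_const _)
    have h1 : ∫ x, g (e k) x ∂area = ∫ x, ((1 - T x ^ 2) * (1 + e k - T x)⁻¹ + 2 * Real.log 2)
        ∂area := by
      rw [← sub_eq_zero, ← integral_sub (hint (hgc k)) hc', ← h]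
      refine integral_congr_ae (Eventually.of_forall fun x => ?_)
      simp only [hg, hT]
      ring
    rw [h1]
    refine integral_mono hc' (integrable_const _) fun x => ?_
    have h2 : 0 < 1 + e k - T x := by linarith [hT1 x, he0 k]
    -- `1 - t² = (1 - t)(1 + t) ≤ 2 (1 - t)`.
    have h3 : (1 - T x ^ 2) * (1 + e k - T x)⁻¹ ≤ 2 := by
      rw [← div_eq_mul_inv, div_le_iff₀ h2]
      nlinarith [hT1 x, hT2 x, he0 k]
    simp only
    linarith
  have hg0 : Integrable (g 0) area := by
    have hae : ∀ᵐ x ∂area, Tendsto (fun k => g (e k) x) atTop (𝓝 (g 0 x)) := by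
      filter_upwards [ae_ne_sph x₀] with x hx
      have hx' : 1 + 0 - T x ≠ 0 := by
        have : T x < 1 := inner_sph_lt_one hx
        linarith
      have h1 : Tendsto (fun k => 1 + e k - T x) atTop (𝓝 (1 + 0 - T x)) :=
        (hlim.const_add 1).sub_const _
      exact ((h1.log hx').const_mul _).add_const _
    have hfatou : ∫⁻ x, ‖g 0 x‖ₑ ∂area ≤ liminf (fun k => ∫⁻ x, ‖g (e k) x‖ₑ ∂area) atTop := by
      rw [lintegral_congr_ae (hae.mono fun x hx => hx.enorm.liminf_eq.symm)]
      exact lintegral_liminf_le fun k => (hgc k).measurable.enorm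
    refine ⟨aestronglyMeasurable_of_tendsto_ae _ (fun k => (hgc k).aestronglyMeasurable) hae,
      lt_of_le_of_lt hfatou (Ne.lt_top ?_)⟩
    · have h1 : ∀ k, ∫⁻ x, ‖g (e k) x‖ₑ ∂area ≤
          ENNReal.ofReal (∫ _x : Sph, (2 + 2 * Real.log 2) ∂area) := by
        intro k
        have h2 : ∀ x, 0 ≤ g (e k) x := fun x =>
          hnonneg _ (he0 k).le (he1 k) x (by linarith [hT1 x, he0 k])
        have h3 : ∫⁻ x, ‖g (e k) x‖ₑ ∂area = ENNReal.ofReal (∫ x, g (e k) x ∂area) := by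
          rw [ofReal_integral_eq_lintegral_ofReal (hint (hgc k)) (Eventually.of_forall h2)]
          refine lintegral_congr fun x => ?_
          rw [Real.enorm_eq_ofReal (h2 x)]
        rw [h3]
        exact ENNReal.ofReal_le_ofReal (hbound k)
      refine ne_top_of_le_ne_top ENNReal.ofReal_ne_top
        (liminf_le_of_frequently_le' (Eventually.of_forall h1).frequently)
  refine Integrable.mono' (hg0.add (integrable_const (Real.log 2)))
    ((measurable_const.sub hTc.measurable).log.aestronglyMeasurable) ?_
  filter_upwards [ae_ne_sph x₀] with x hx
  have hpos : 0 < 1 - T x := by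
    have : T x < 1 := inner_sph_lt_one hx
    linarith
  have hg0x := hnonneg 0 le_rfl zero_le_one x (by linarith)
  change |Real.log (1 - T x)| ≤ g 0 x + Real.log 2
  -- For `t ≥ 1/2` the logarithm is nonpositive and `2t ≥ 1`, so `g 0` dominates; for `t ≤ 1/2` the
  -- argument lies between `1/2` and `2`.
  rcases le_total (1 / 2) (T x) with h | h
  · have h1 : Real.log (1 - T x) ≤ 0 := Real.log_nonpos hpos.le (by linarith)
    rw [abs_of_nonpos h1]
    simp only [hg, add_zero]
    nlinarith
  · have h1 : Real.log (1 - T x) ≤ Real.log 2 := Real.log_le_log hpos (by linarith [hT2 x])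
    have h2 : -Real.log 2 ≤ Real.log (1 - T x) := by
      rw [← Real.log_inv]
      exact Real.log_le_log (by norm_num) (by norm_num; linarith)
    exact (abs_le.2 ⟨h2, h1⟩).trans (by linarith)

lemma integrable_fundSol (x₀ : Sph) : Integrable (fun x => fundSol x x₀) area :=
  (integrable_log_one_sub_inner x₀).const_mul _

/-! ### The representation formula -/

/-- Away from its pole the fundamental solution stays away from its singularity. -/
lemma exists_pos_le_one_sub_inner {O : Set Sph} (hO : IsOpen O) {x₀ : Sph} (hx₀ : x₀ ∈ O) :
    ∃ m > 0, ∀ x ∉ O, m ≤ 1 - ⟪(x : E3), (x₀ : E3)⟫ := by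
  rcases (Oᶜ).eq_empty_or_nonempty with h | h
  · exact ⟨1, one_pos, fun x hx => absurd (show x ∈ Oᶜ from hx) (by simp [h])⟩
  · obtain ⟨z, hz, hmin⟩ := hO.isClosed_compl.isCompact.exists_isMinOn h
      (continuous_const.sub (continuous_height x₀) :
        Continuous fun x : Sph => (1 : ℝ) - ⟪(x : E3), (x₀ : E3)⟫).continuousOn
    refine ⟨_, sub_pos.2 (inner_sph_lt_one (x := z) fun hzx => hz (hzx ▸ hx₀)), fun x hx => hmin hx⟩

lemma regKernel_nonneg {ε : ℝ} (hε : 0 < ε) (x₀ x : Sph) : 0 ≤ regKernel ε x₀ x := by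
  have := Real.pi_pos
  unfold regKernel
  positivity

/-- The kernels `regKernel ε` form an approximate identity. -/
lemma tendsto_integral_regKernel {x₀ : Sph} {g : Sph → ℝ} (hg : Integrable g area)
    (hc : ContinuousAt g x₀) :
    Tendsto (fun ε => ∫ x, regKernel ε x₀ x * g x ∂area) (𝓝[>] 0) (𝓝 (g x₀)) := by
  have hpos : ∀ᶠ ε : ℝ in 𝓝[>] 0, 0 < ε := eventually_mem_nhdsWithin
  have h := tendsto_setIntegral_peak_smul_of_integrableOn_of_tendsto (μ := area)
    (φ := fun ε => regKernel ε x₀) (l := 𝓝[>] (0 : ℝ)) (s := univ) (x₀ := x₀) (g := g)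
    (a := g x₀) MeasurableSet.univ (t := univ) MeasurableSet.univ Subset.rfl univ_mem
    (measure_ne_top _ _) (hpos.mono fun ε hε x _ => regKernel_nonneg hε x₀ x) ?_ ?_
    (hpos.mono fun ε hε => (continuous_regKernel hε x₀).aestronglyMeasurable)
    hg.integrableOn (hc.tendsto.mono_left nhdsWithin_le_nhds)
  · simpa using h
  · intro O hO hx₀
    obtain ⟨m, hm, hle⟩ := exists_pos_le_one_sub_inner hO hx₀
    rw [Metric.tendstoUniformlyOn_iff]
    intro η hη
    -- Off `O` the denominator `1 + ε - t` is at least `m`, which bounds the kernel uniformly.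
    have hlim : Tendsto (fun ε : ℝ => 1 / (4 * Real.pi) * (2 * ε + ε ^ 2) * (m⁻¹) ^ 2) (𝓝[>] 0)
        (𝓝 0) := by
      have hcont : Continuous fun ε : ℝ => 1 / (4 * Real.pi) * (2 * ε + ε ^ 2) * (m⁻¹) ^ 2 := by
        fun_prop
      have := hcont.tendsto 0
      simp only [mul_zero, zero_mul, add_zero, ne_eq, OfNat.ofNat_ne_zero, not_false_eq_true,
        zero_pow] at this
      exact this.mono_left nhdsWithin_le_nhds
    filter_upwards [hlim.eventually (gt_mem_nhds hη), hpos] with ε h1 hε x hx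
    have hpi := Real.pi_pos
    rw [Pi.zero_apply, dist_comm, Real.dist_eq, sub_zero, abs_of_nonneg (regKernel_nonneg hε x₀ x)]
    refine lt_of_le_of_lt ?_ h1
    unfold regKernel
    have hmx : m ≤ 1 + ε - ⟪(x : E3), (x₀ : E3)⟫ := by linarith [hle x hx.2]
    gcongr
    exact inv_nonneg.2 (hm.le.trans hmx)
  · refine (tendsto_const_nhds (x := (1 : ℝ))).congr' (hpos.mono fun ε hε => ?_)
    simp [integral_regKernel hε x₀]

/-! ### The tangential component of the surface curl -/

lemma continuous_cross : Continuous fun p : E3 × E3 => cross p.1 p.2 := by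
  unfold cross
  refine (PiLp.continuous_toLp 2 _).comp (continuous_pi fun i => ?_)
  simp only [cross_apply]
  fin_cases i <;> simp <;> fun_prop

/-- For a gradient `a` at the point `b` of the curve and `v` the velocity, the right side is minus
the outward flux density; hence the signs of the line integrals in the formula. -/
lemma inner_cross_eq (a b v : E3) : ⟪cross a b, v⟫ = -det3 a v b := by
  simp only [inner_eq_coord, cross, cross_apply, det3]
  simp
  ring

lemma lineIntegral_eq {γ : ℝ → Sph} {L : ℝ} (hγ : IsSimpleClosedCurve γ L) (V : Sph → E3) :
    lineIntegral γ L V = ∫ s in (0 : ℝ)..L, ⟪V (γ s), velocity γ s⟫ := by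
  refine intervalIntegral.integral_congr fun s _ => ?_
  have h := norm_ne_zero_iff.2 (hγ.velocity_ne_zero s)
  simp only [unitTangent, real_inner_smul_right]
  field_simp

lemma boundaryCurl_eq {u : Sph → ℝ} {G : Sph → E3} {S : Set Sph}
    (hGc : ContinuousOn G (closure S)) (hG : EqOn G (surfGrad u) S) {x : Sph}
    (hx : x ∈ closure S) : boundaryCurl u S x = cross (G x) x := by
  refine extendFrom_eq hx ?_
  have h1 : Tendsto (fun z : Sph => cross (G z) z) (𝓝[S] x) (𝓝 (cross (G x) x)) := by
    have h2 : Tendsto (fun z : Sph => (G z, (z : E3))) (𝓝[S] x) (𝓝 (G x, (x : E3))) :=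
      ((hGc x hx).mono subset_closure).tendsto.prodMk_nhds
        (continuous_subtype_val.continuousAt.mono_left nhdsWithin_le_nhds)
    exact (continuous_cross.tendsto _).comp h2
  refine h1.congr' ?_
  filter_upwards [self_mem_nhdsWithin] with z hz
  rw [surfCurl, hG hz]

lemma continuousOn_laplaceBeltrami {u : Sph → ℝ} {S : Set Sph} (hSo : IsOpen S)
    (hu : ContDiffOn ℝ 2 (homExt u) (cone S)) : ContinuousOn (laplaceBeltrami u) S := by
  have h1 : ContinuousOn (divE (gradient (homExt u))) (cone S) := by
    unfold divE
    have h2 := (contDiffOn_gradient (isOpen_cone hSo) hu).continuousOn_fderiv_of_isOpen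
      (isOpen_cone hSo) le_rfl
    refine continuousOn_finsetSum _ fun i _ => ?_
    exact (EuclideanSpace.proj i : E3 →L[ℝ] ℝ).continuous.comp_continuousOn
      (h2.clm_apply continuousOn_const)
  refine (h1.comp continuous_subtype_val.continuousOn fun x hx => coe_mem_cone.2 hx).congr ?_
  intro x hx
  exact (divE_gradient (hu.contDiffAt ((isOpen_cone hSo).mem_nhds (coe_mem_cone.2 hx)))).symm

/-! ### Area integrals against the fundamental solution -/

lemma abs_log_le {a m M : ℝ} (hm : 0 < m) (h1 : m ≤ a) (h2 : a ≤ M) :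
    |Real.log a| ≤ |Real.log m| + |Real.log M| := by
  have h3 := Real.log_le_log hm h1
  have h4 := Real.log_le_log (hm.trans_le h1) h2
  rw [abs_le]
  constructor
  · linarith [neg_abs_le (Real.log m), abs_nonneg (Real.log M)]
  · linarith [le_abs_self (Real.log M), abs_nonneg (Real.log m)]

lemma measurable_fundSol (x₀ : Sph) : Measurable fun x => fundSol x x₀ :=
  ((measurable_const.sub (continuous_height x₀).measurable).log).const_mul _

lemma integrableOn_fundSol_mul_sdiff {w : Sph → ℝ} {S O : Set Sph} {x₀ : Sph}
    (hw : IntegrableOn w S area) (hSo : IsOpen S) (hO : IsOpen O) (hx₀ : x₀ ∈ O) :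
    IntegrableOn (fun x => fundSol x x₀ * w x) (S \ O) area := by
  obtain ⟨m, hm, hle⟩ := exists_pos_le_one_sub_inner hO hx₀
  refine (hw.mono_set sdiff_subset).bdd_mul
    (c := |-(1 / (4 * Real.pi))| * (|Real.log m| + |Real.log 2|))
    (measurable_fundSol x₀).aestronglyMeasurable ?_
  rw [ae_restrict_iff' (hSo.measurableSet.diff hO.measurableSet)]
  refine Eventually.of_forall fun x hx => ?_
  rw [fundSol, norm_mul, Real.norm_eq_abs, Real.norm_eq_abs]
  refine mul_le_mul_of_nonneg_left (abs_log_le hm (hle x hx.2) ?_) (abs_nonneg _)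
  linarith [neg_one_le_inner_sph x x₀]

lemma integrableOn_fundSol_mul_of_isCompact {w : Sph → ℝ} {K : Set Sph} (hK : IsCompact K)
    (hw : ContinuousOn w K) (x₀ : Sph) : IntegrableOn (fun x => fundSol x x₀ * w x) K area := by
  obtain ⟨C, hC⟩ := hK.exists_bound_of_continuousOn hw
  refine (integrable_fundSol x₀).integrableOn.mul_bdd (c := C)
    (hw.aestronglyMeasurable hK.measurableSet) ?_
  rw [ae_restrict_iff' hK.measurableSet]
  exact Eventually.of_forall hC

/-- Away from `x₀` the fundamental solution is bounded and `Δu` integrable. If `x₀ ∈ S₂`, the roles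
are exchanged on a compact neighbourhood of `x₀` inside `S₂`, where `Δu` is continuous and hence
bounded. -/
lemma integrableOn_fundSol_mul_laplaceBeltrami {u : Sph → ℝ} {S₁ S₂ : Set Sph} {x₀ : Sph}
    (h₁ : IsOpen S₁) (h₂ : IsOpen S₂) (hdisj : Disjoint S₁ S₂) (hx₀ : x₀ ∈ S₁ ∪ S₂)
    (hu : ContDiffOn ℝ 2 (homExt u) (cone S₂)) (hΔ : IntegrableOn (laplaceBeltrami u) S₂ area) :
    IntegrableOn (fun x => fundSol x x₀ * laplaceBeltrami u x) S₂ area := by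
  rcases hx₀ with h | h
  · have := integrableOn_fundSol_mul_sdiff hΔ h₂ h₁ h
    rwa [hdisj.symm.sdiff_eq_left] at this
  · obtain ⟨K, hK, hxK, hKS⟩ := exists_compact_subset h₂ h
    have i1 := integrableOn_fundSol_mul_sdiff hΔ h₂ isOpen_interior hxK
    have i2 := integrableOn_fundSol_mul_of_isCompact hK
      ((continuousOn_laplaceBeltrami h₂ hu).mono hKS) x₀
    refine (i1.union i2).mono_set fun x hx => ?_
    by_cases hxi : x ∈ interior K
    · exact Or.inr (interior_subset hxi)
    · exact Or.inl ⟨hx, hxi⟩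

/-- For `0 < ε ≤ 1` one has `1 - t ≤ 1 + ε - t ≤ 3`, so `|U_ε|` is at most `|U*|` plus a constant,
and convergence is dominated. -/
lemma tendsto_integral_regSol_mul {w : Sph → ℝ} {S : Set Sph} {x₀ : Sph}
    (hw : IntegrableOn w S area) (hfw : IntegrableOn (fun x => fundSol x x₀ * w x) S area) :
    Tendsto (fun ε => ∫ x in S, regSol ε x₀ x * w x ∂area) (𝓝[>] 0)
      (𝓝 (∫ x in S, fundSol x x₀ * w x ∂area)) := by
  have hpos : ∀ᶠ ε : ℝ in 𝓝[>] 0, ε ∈ Ioc 0 1 := Ioc_mem_nhdsGT one_pos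
  set C := |-(1 / (4 * Real.pi))| * |Real.log 3| with hC
  refine tendsto_integral_filter_of_dominated_convergence
    (fun x => ‖fundSol x x₀ * w x‖ + C * ‖w x‖) ?_ ?_ (hfw.norm.add (hw.norm.const_mul C)) ?_
  · filter_upwards [hpos] with ε hε
    exact (continuous_regSol hε.1 x₀).aestronglyMeasurable.mul hw.aestronglyMeasurable
  · filter_upwards [hpos] with ε hε
    filter_upwards [ae_restrict_of_ae (ae_ne_sph x₀)] with x hx
    have h1 := inner_sph_lt_one hx
    have h2 := neg_one_le_inner_sph x x₀
    have h3 := abs_log_le (a := 1 + ε - ⟪(x : E3), (x₀ : E3)⟫)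
      (m := 1 - ⟪(x : E3), (x₀ : E3)⟫) (M := 3) (by linarith) (by linarith [hε.1])
      (by linarith [hε.2])
    rw [norm_mul, norm_mul, ← add_mul]
    refine mul_le_mul_of_nonneg_right ?_ (norm_nonneg _)
    rw [regSol, fundSol, norm_mul, norm_mul, Real.norm_eq_abs, Real.norm_eq_abs, Real.norm_eq_abs,
      hC, ← mul_add]
    exact mul_le_mul_of_nonneg_left h3 (abs_nonneg _)
  · filter_upwards [ae_restrict_of_ae (ae_ne_sph x₀)] with x hx
    have h1 : 1 - ⟪(x : E3), (x₀ : E3)⟫ ≠ 0 := by linarith [inner_sph_lt_one hx]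
    have h2 : Tendsto (fun ε : ℝ => 1 + ε - ⟪(x : E3), (x₀ : E3)⟫) (𝓝[>] 0)
        (𝓝 (1 - ⟪(x : E3), (x₀ : E3)⟫)) := by
      have h3 : Continuous fun ε : ℝ => 1 + ε - ⟪(x : E3), (x₀ : E3)⟫ := by fun_prop
      have := h3.tendsto 0
      rw [add_zero] at this
      exact this.mono_left nhdsWithin_le_nhds
    exact ((h2.log h1).const_mul _).mul_const _

/-- Integrals over a curve that avoids the pole depend continuously on the regularisation. -/
lemma tendsto_intervalIntegral_of_continuous_abs {F : ℝ → ℝ → ℝ} {L : ℝ}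
    (hF : Continuous (fun p : ℝ × ℝ => F |p.1| p.2)) :
    Tendsto (fun ε => ∫ s in (0 : ℝ)..L, F ε s) (𝓝[>] 0) (𝓝 (∫ s in (0 : ℝ)..L, F 0 s)) := by
  -- With `|ε|` in place of `ε` the integrand is continuous on the whole plane, and the one-sided
  -- limit becomes continuity at `0`.
  have h := intervalIntegral.continuous_parametric_intervalIntegral_of_continuous'
    (μ := volume) (f := fun ε s => F |ε| s) hF 0 L
  have h1 := (h.tendsto 0).mono_left (nhdsWithin_le_nhds (s := Ioi 0))
  rw [abs_zero] at h1
  refine h1.congr' ?_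
  filter_upwards [self_mem_nhdsWithin] with ε hε
  rw [abs_of_pos hε]

/-- Green's identity with the regularised fundamental solution. -/
lemma green_regSol {γ : ℝ → Sph} {L : ℝ} {S₁ S₂ : Set Sph}
    (hγ : IsSimpleClosedCurve γ L) (hS : Divides γ S₁ S₂) (hor : PositivelyOriented γ S₂)
    {u : Sph → ℝ} {G : Sph → E3} (hu : ContDiffOn ℝ 2 (homExt u) (cone S₂))
    (huc : ContinuousOn u (closure S₂)) (hGc : ContinuousOn G (closure S₂))
    (hG : EqOn G (surfGrad u) S₂) (hΔ : IntegrableOn (laplaceBeltrami u) S₂ area) {ε : ℝ}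
    (hε : 0 < ε) (x₀ : Sph) :
    1 / (4 * Real.pi) * (∫ x in S₂, u x ∂area) - (∫ x in S₂, regKernel ε x₀ x * u x ∂area)
      - (∫ x in S₂, regSol ε x₀ x * laplaceBeltrami u x ∂area) =
      (∫ s in (0 : ℝ)..L, u (γ s) * det3 (zonal (regSlope ε) x₀ (γ s)) (velocity γ s) (γ s)) -
      ∫ s in (0 : ℝ)..L, regSol ε x₀ (γ s) * det3 (G (γ s)) (velocity γ s) (γ s) := by
  have hF := isDivField_greenField (x₀ := x₀) hε hS.isOpen₂ hu huc hGc hG hΔ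
  have key := integral_surfDiv_eq_integral_det3 hγ hS hor hF
  have hcl : ∀ s, γ s ∈ closure S₂ := fun s => by
    have : γ s ∈ frontier S₂ := hS.frontier₂ ▸ ⟨s, rfl⟩
    exact this.1
  have hγc := hγ.continuous
  have hγc' : Continuous fun s => (γ s : E3) := continuous_subtype_val.comp hγc
  have hv : Continuous (velocity γ) := hγ.contDiff.continuous_deriv le_rfl
  have c1 : Continuous fun s =>
      u (γ s) * det3 (zonal (regSlope ε) x₀ (γ s)) (velocity γ s) (γ s) := by
    rw [← continuousOn_univ]
    exact (huc.comp_continuous hγc hcl).continuousOn.mul (continuousOn_det3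
      ((continuous_zonal (continuousOn_regSlope hε) x₀).comp hγc).continuousOn hv.continuousOn
      hγc'.continuousOn)
  have c2 : Continuous fun s => regSol ε x₀ (γ s) * det3 (G (γ s)) (velocity γ s) (γ s) := by
    rw [← continuousOn_univ]
    exact ((continuous_regSol hε x₀).comp hγc).continuousOn.mul (continuousOn_det3
      (hGc.comp_continuous hγc hcl).continuousOn hv.continuousOn hγc'.continuousOn)
  have hcpt : IsCompact (closure S₂) := isClosed_closure.isCompact
  have i1 : IntegrableOn (fun x => 1 / (4 * Real.pi) * u x) S₂ area :=
    ((continuousOn_const.mul huc).integrableOn_compact hcpt).mono_set subset_closure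
  have i2 : IntegrableOn (fun x => regKernel ε x₀ x * u x) S₂ area :=
    (((continuous_regKernel hε x₀).continuousOn.mul huc).integrableOn_compact hcpt).mono_set
      subset_closure
  have i3 : IntegrableOn (fun x => regSol ε x₀ x * laplaceBeltrami u x) S₂ area := by
    have hc := continuous_regSol hε x₀
    obtain ⟨C, hC⟩ := isCompact_univ.exists_bound_of_continuousOn hc.continuousOn
    exact hΔ.bdd_mul (c := C) hc.aestronglyMeasurable
      (Eventually.of_forall fun x => hC x (mem_univ x))
  have i12 : IntegrableOn (fun x => 1 / (4 * Real.pi) * u x - regKernel ε x₀ x * u x) S₂ area :=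
    i1.sub i2
  rw [← intervalIntegral.integral_sub (c1.intervalIntegrable _ _) (c2.intervalIntegrable _ _),
    ← integral_const_mul, ← integral_sub i1 i2, ← integral_sub i12 i3]
  rw [setIntegral_congr_fun hS.isOpen₂.measurableSet
    (fun x hx => surfDiv_greenField hε hS.isOpen₂ hu hG hx)] at key
  refine Eq.trans ?_ (key.trans ?_)
  · congr 1
    ext1 x
    ring
  · refine intervalIntegral.integral_congr fun s _ => ?_
    simp only [greenField, det3, PiLp.sub_apply, PiLp.smul_apply, smul_eq_mul]
    ring

/-- The left-hand side of the representation formula as a limit of smoothed values of `u`. -/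
lemma tendsto_integral_regKernel_reprLHS {γ : ℝ → Sph} {L : ℝ} {S₁ S₂ : Set Sph}
    (hγ : IsSimpleClosedCurve γ L) (hS : Divides γ S₁ S₂) (hor : PositivelyOriented γ S₂)
    {u : Sph → ℝ} {G : Sph → E3} (hu : ContDiffOn ℝ 2 (homExt u) (cone S₂))
    (huc : ContinuousOn u (closure S₂)) (hGc : ContinuousOn G (closure S₂))
    (hG : EqOn G (surfGrad u) S₂) (hΔ : IntegrableOn (laplaceBeltrami u) S₂ area) {x₀ : Sph}
    (hx₀ : x₀ ∉ range γ)
    (hfΔ : IntegrableOn (fun x => fundSol x x₀ * laplaceBeltrami u x) S₂ area) :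
    Tendsto (fun ε => ∫ x in S₂, regKernel ε x₀ x * u x ∂area) (𝓝[>] 0)
      (𝓝 (reprLHS γ L S₂ u x₀)) := by
  have hcl : ∀ s, γ s ∈ closure S₂ := fun s => by
    have : γ s ∈ frontier S₂ := hS.frontier₂ ▸ ⟨s, rfl⟩
    exact this.1
  have hγc := hγ.continuous
  have hγc' : Continuous fun s => (γ s : E3) := continuous_subtype_val.comp hγc
  have hv : Continuous (velocity γ) := hγ.contDiff.continuous_deriv le_rfl
  have hlt : ∀ s, ⟪(γ s : E3), (x₀ : E3)⟫ < 1 := fun s =>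
    inner_sph_lt_one fun h => hx₀ ⟨s, h⟩
  -- Since the pole is off the curve, the denominators do not vanish even at `ε = 0`.
  have hne : ∀ p : ℝ × ℝ, 1 + |p.1| - ⟪(γ p.2 : E3), (x₀ : E3)⟫ ≠ 0 := fun p => by
    have := hlt p.2
    have := abs_nonneg p.1
    linarith
  have hden : Continuous fun p : ℝ × ℝ => 1 + |p.1| - ⟪(γ p.2 : E3), (x₀ : E3)⟫ := by
    have : Continuous fun p : ℝ × ℝ => (γ p.2 : E3) := hγc'.comp continuous_snd
    fun_prop
  have l1 := tendsto_integral_regSol_mul hΔ hfΔ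
  have l2 : Tendsto (fun ε => ∫ s in (0 : ℝ)..L,
      u (γ s) * det3 (zonal (regSlope ε) x₀ (γ s)) (velocity γ s) (γ s)) (𝓝[>] 0)
      (𝓝 (∫ s in (0 : ℝ)..L,
        u (γ s) * det3 (zonal (regSlope 0) x₀ (γ s)) (velocity γ s) (γ s))) := by
    refine tendsto_intervalIntegral_of_continuous_abs (F := fun ε s =>
      u (γ s) * det3 (zonal (regSlope ε) x₀ (γ s)) (velocity γ s) (γ s)) ?_
    rw [← continuousOn_univ]
    refine ((huc.comp_continuous hγc hcl).comp continuous_snd).continuousOn.mul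
      (continuousOn_det3 (Continuous.continuousOn ?_) (hv.comp continuous_snd).continuousOn
        (hγc'.comp continuous_snd).continuousOn)
    exact (continuous_const.mul (hden.inv₀ hne)).smul
      ((continuous_heightGrad x₀).comp (hγc.comp continuous_snd))
  have l3 : Tendsto (fun ε => ∫ s in (0 : ℝ)..L,
      regSol ε x₀ (γ s) * det3 (G (γ s)) (velocity γ s) (γ s)) (𝓝[>] 0)
      (𝓝 (∫ s in (0 : ℝ)..L, regSol 0 x₀ (γ s) * det3 (G (γ s)) (velocity γ s) (γ s))) := by
    refine tendsto_intervalIntegral_of_continuous_abs (F := fun ε s =>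
      regSol ε x₀ (γ s) * det3 (G (γ s)) (velocity γ s) (γ s)) ?_
    rw [← continuousOn_univ]
    refine (Continuous.continuousOn ?_).mul (continuousOn_det3
      ((hGc.comp_continuous hγc hcl).comp continuous_snd).continuousOn
      (hv.comp continuous_snd).continuousOn (hγc'.comp continuous_snd).continuousOn)
    exact continuous_const.mul (hden.log hne)
  have hrepr : reprLHS γ L S₂ u x₀ = 1 / (4 * Real.pi) * (∫ x in S₂, u x ∂area) -
      (∫ x in S₂, fundSol x x₀ * laplaceBeltrami u x ∂area) +
      (∫ s in (0 : ℝ)..L, regSol 0 x₀ (γ s) * det3 (G (γ s)) (velocity γ s) (γ s)) -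
      ∫ s in (0 : ℝ)..L, u (γ s) * det3 (zonal (regSlope 0) x₀ (γ s)) (velocity γ s) (γ s) := by
    have e1 : lineIntegral γ L (fun x => fundSol x x₀ • boundaryCurl u S₂ x) =
        -∫ s in (0 : ℝ)..L, regSol 0 x₀ (γ s) * det3 (G (γ s)) (velocity γ s) (γ s) := by
      rw [lineIntegral_eq hγ, ← intervalIntegral.integral_neg]
      refine intervalIntegral.integral_congr fun s _ => ?_
      rw [boundaryCurl_eq hGc hG (hcl s), real_inner_smul_left, inner_cross_eq,
        ← congrFun (fundSol_eq_regSol x₀) (γ s)]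
      ring
    have e2 : lineIntegral γ L (fun x => u x • surfCurl (fun y => fundSol y x₀) x) =
        -∫ s in (0 : ℝ)..L,
          u (γ s) * det3 (zonal (regSlope 0) x₀ (γ s)) (velocity γ s) (γ s) := by
      rw [lineIntegral_eq hγ, ← intervalIntegral.integral_neg]
      refine intervalIntegral.integral_congr fun s _ => ?_
      have h0 : 1 + 0 - ⟪(γ s : E3), (x₀ : E3)⟫ ≠ 0 := by linarith [hlt s]
      rw [real_inner_smul_left, surfCurl, inner_cross_eq, fundSol_eq_regSol, surfGrad_regSol h0]
      ring
    rw [reprLHS, e1, e2]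
    ring
  rw [hrepr]
  have hlim := (((tendsto_const_nhds (x := 1 / (4 * Real.pi) * (∫ x in S₂, u x ∂area))).sub
    l1).add l3).sub l2
  refine hlim.congr' ?_
  filter_upwards [self_mem_nhdsWithin] with ε hε
  have := green_regSol hγ hS hor hu huc hGc hG hΔ hε x₀
  linarith

end SphereRepr

end

theorem mainTheorem1
    (γ : ℝ → SphereRepr.Sph) (L : ℝ) (S₁ S₂ : Set SphereRepr.Sph)
    (hγ : SphereRepr.IsSimpleClosedCurve γ L)
    (hS : SphereRepr.Divides γ S₁ S₂)
    (hor : SphereRepr.PositivelyOriented γ S₂)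
    (u : SphereRepr.Sph → ℝ)
    (hu2 : SphereRepr.IsC2On u S₂)
    (hu1 : SphereRepr.IsC1UpToBoundary u S₂)
    (hΔ : IntegrableOn (SphereRepr.laplaceBeltrami u) S₂ SphereRepr.area)
    (x₀ : SphereRepr.Sph) (hx₀ : x₀ ∉ range γ) :
    IntegrableOn (fun x => SphereRepr.fundSol x x₀ * SphereRepr.laplaceBeltrami u x) S₂
        SphereRepr.area ∧
      (x₀ ∈ S₂ → SphereRepr.reprLHS γ L S₂ u x₀ = u x₀) ∧
      (x₀ ∈ S₁ → SphereRepr.reprLHS γ L S₂ u x₀ = 0) := by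
  obtain ⟨G, hGc, hG⟩ := hu1.exists_grad
  have hu := SphereRepr.ContMDiffOn.contDiffOn_homExt hu2
  have hx₀' : x₀ ∈ S₁ ∪ S₂ := by
    rw [hS.union]
    exact hx₀
  have hfΔ := SphereRepr.integrableOn_fundSol_mul_laplaceBeltrami hS.isOpen₁ hS.isOpen₂
    hS.disjoint hx₀' hu hΔ
  have hlim := SphereRepr.tendsto_integral_regKernel_reprLHS hγ hS hor hu hu1.continuousOn hGc hG
    hΔ hx₀ hfΔ
  -- Extended by zero, `u` is continuous at `x₀` in both cases, since `x₀` is interior to `S₂` or to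
  -- `S₁`; a single approximate identity on the whole sphere then serves both.
  have hint : Integrable (S₂.indicator u) SphereRepr.area :=
    ((hu1.continuousOn.integrableOn_compact isClosed_closure.isCompact).mono_set
      subset_closure).integrable_indicator hS.isOpen₂.measurableSet
  have heq : ∀ ε, ∫ x in S₂, SphereRepr.regKernel ε x₀ x * u x ∂SphereRepr.area =
      ∫ x, SphereRepr.regKernel ε x₀ x * S₂.indicator u x ∂SphereRepr.area := fun ε => by
    rw [← integral_indicator hS.isOpen₂.measurableSet]
    refine integral_congr_ae (Eventually.of_forall fun x => ?_)
    by_cases hx : x ∈ S₂ <;> simp [hx]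
  simp only [heq] at hlim
  refine ⟨hfΔ, fun h2 => ?_, fun h1 => ?_⟩
  · have hn := hS.isOpen₂.mem_nhds h2
    have hc : ContinuousAt (S₂.indicator u) x₀ :=
      (hu1.continuousOn.continuousAt (mem_of_superset hn subset_closure)).congr
        (eventuallyEq_of_mem hn fun x hx => (indicator_of_mem hx u).symm)
    have := tendsto_nhds_unique hlim (SphereRepr.tendsto_integral_regKernel hint hc)
    rwa [indicator_of_mem h2] at this
  · have hn := hS.isOpen₁.mem_nhds h1
    have hout : ∀ x ∈ S₁, S₂.indicator u x = 0 := fun x hx =>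
      indicator_of_notMem (disjoint_left.1 hS.disjoint hx) u
    have hc : ContinuousAt (S₂.indicator u) x₀ :=
      (continuousAt_const (y := (0 : ℝ))).congr
        (eventuallyEq_of_mem hn fun x hx => (hout x hx).symm)
    have := tendsto_nhds_unique hlim (SphereRepr.tendsto_integral_regKernel hint hc)
    rwa [hout x₀ h1] at this
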